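/- Let $\mathbb{A}$ be one of the normed division algebras $\mathbb{R},\mathbb{C},\mathbb{H},\mathbb{O}$, with its standard Euclidean inner product; here $\mathbb{O}=\mathbb{H}\oplus\mathbb{H}$ with the Cayley--Dickson product $(a,b)(c,d)=(ac-d\bar b,\ \bar a d+cb)$. Let $\mathbb{A}^n$ carry the inner product $\langle u,v\rangle=\sum_i\langle u_i,v_i\rangle$ and the componentwise right multiplication $(vx)_i=v_ix$. Let $SO(\mathbb{A})$ be the group of real-linear isometries of $\mathbb{A}$ of determinant $1$, and let $G_{\mathbb{A}}(n)$ be the group of all real-linear isometries $\phi$ of $\mathbb{A}^n$ for which there is $\theta\in SO(\mathbb{A})$ such that $\phi(vx)=\phi(v)\theta(x)$ for all $v\in\mathbb{A}^n$ and $x\in\mathbb{A}$. Then: 1. For every $n$, $G_{\mathbb{R}}(n)=O(n)$: the maps in $G_{\mathbb{R}}(n)$ are exactly the maps $v\mapsto Bv$ with $B$ a real orthogonal $n\times n$ matrix. 2. For every $n$, $G_{\mathbb{C}}(n)=U(n)$: the maps in $G_{\mathbb{C}}(n)$ are exactly the maps $v\mapsto Bv$ with $B$ a complex unitary $n\times n$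 matrix. 3. For every $n$, $G_{\mathbb{H}}(n)=Sp(n)Sp(1)$: let $Sp(n)$ be the group of quaternionic $n\times n$ matrices $B$ with $B^*B=BB^*=1$, and $Sp(1)$ the group of unit quaternions. Then $(B,q)\mapsto(v\mapsto Bvq^{-1})$ is a homomorphism from $Sp(n)\times Sp(1)$ to the group of real-linear isometries of $\mathbb{H}^n$ with image $G_{\mathbb{H}}(n)$, and for $n\ge 1$ its kernel is $\{(1,1),(-1,-1)\}$. 4. $G_{\mathbb{O}}(1)=Spin(7)$: there are a representation $\Psi$ of the even Clifford algebra of Euclidean $\mathbb{R}^7$ by real-linear endomorphisms of $\mathbb{O}$ and a group isomorphism $e\colon Spin(7)\to G_{\mathbb{O}}(1)$ such that $e(s)=\Psi(s)$ for all $s\in Spin(7)$; that is, $Spin(7)$ acts on $\mathbb{O}=\mathbb{R}^8$ by its spin representation. -/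

import Mathlib

open scoped Quaternion Matrix

noncomputable section

/-- The octonions `𝕆 = ℍ ⊕ ℍ` (Cayley–Dickson doubling of the quaternions), with the Euclidean
inner product of `ℝ⁸ = ℍ ⊕ ℍ`. -/
def Octonion : Type := WithLp 2 (ℍ[ℝ] × ℍ[ℝ])

namespace Octonion

instance : NormedAddCommGroup Octonion :=
  inferInstanceAs (NormedAddCommGroup (WithLp 2 (ℍ[ℝ] × ℍ[ℝ])))

instance : InnerProductSpace ℝ Octonion :=
  inferInstanceAs (InnerProductSpace ℝ (WithLp 2 (ℍ[ℝ] × ℍ[ℝ])))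

/-- The octonion `(a, b)`. -/
def mk (a b : ℍ[ℝ]) : Octonion := WithLp.toLp 2 (a, b)

/-- The first quaternionic component. -/
def fst (x : Octonion) : ℍ[ℝ] := (WithLp.ofLp x).1

/-- The second quaternionic component. -/
def snd (x : Octonion) : ℍ[ℝ] := (WithLp.ofLp x).2

/-- Cayley–Dickson multiplication `(a, b)(c, d) = (a c - d b*, a* d + c b)`. -/
instance : Mul Octonion where
  mul x y := mk (x.fst * y.fst - y.snd * star x.snd) (star x.fst * y.snd + y.fst * x.snd)

end Octonion

section Twisted

variable (A : Type*) [NormedAddCommGroup A] [InnerProductSpace ℝ A]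

/-- `Aⁿ` with the inner product `⟨u, v⟩ = ∑ i, ⟨u i, v i⟩`. -/
abbrev LinearSpaceOver (n : ℕ) : Type _ := PiLp 2 (fun _ : Fin n => A)

/-- `SO(A)`: the real-linear isometries of `A` of determinant one. -/
def specialOrthogonal : Subgroup (A ≃ₗᵢ[ℝ] A) where
  carrier := {θ | LinearMap.det (θ.toLinearEquiv : A →ₗ[ℝ] A) = 1}
  one_mem' := by
    change LinearMap.det (LinearMap.id : A →ₗ[ℝ] A) = 1
    exact LinearMap.det_id
  mul_mem' := by
    intro a b ha hb
    change LinearMap.det ((a.toLinearEquiv : A →ₗ[ℝ] A) ∘ₗ (b.toLinearEquiv : A →ₗ[ℝ] A)) = 1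
    rw [LinearMap.det_comp, show LinearMap.det (a.toLinearEquiv : A →ₗ[ℝ] A) = 1 from ha,
      show LinearMap.det (b.toLinearEquiv : A →ₗ[ℝ] A) = 1 from hb, one_mul]
  inv_mem' := by
    intro a ha
    change LinearMap.det (a.toLinearEquiv.symm : A →ₗ[ℝ] A) = 1
    have h := a.toLinearEquiv.det_symm_mul_det
    rwa [show LinearMap.det (a.toLinearEquiv : A →ₗ[ℝ] A) = 1 from ha, mul_one] at h

variable {A} in
/-- Right multiplication of a vector of `Aⁿ` by an element of `A`. -/
def rightMul [Mul A] {n : ℕ} (v : LinearSpaceOver A n) (x : A) : LinearSpaceOver A n :=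
  WithLp.toLp 2 (fun i => v i * x)

/-- `G_A(n)`: the group of twisted isomorphisms of `Aⁿ`, i.e. of the real-linear isometries `φ`
for which there is `θ ∈ SO(A)` with `φ (v x) = φ(v) θ(x)` for all `v` and `x`. -/
def twistedIso [Mul A] (n : ℕ) :
    Subgroup (LinearSpaceOver A n ≃ₗᵢ[ℝ] LinearSpaceOver A n) where
  carrier := {φ | ∃ θ ∈ specialOrthogonal A, ∀ (v : LinearSpaceOver A n) (x : A),
    φ (rightMul v x) = rightMul (φ v) (θ x)}
  one_mem' := ⟨1, one_mem _, fun _ _ => rfl⟩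
  mul_mem' := by
    rintro φ ψ ⟨θ, hθ, h⟩ ⟨η, hη, k⟩
    refine ⟨θ * η, mul_mem hθ hη, fun v x => ?_⟩
    change φ (ψ (rightMul v x)) = rightMul (φ (ψ v)) (θ (η x))
    rw [k, h]
  inv_mem' := by
    rintro φ ⟨θ, hθ, h⟩
    refine ⟨θ⁻¹, inv_mem hθ, fun v x => ?_⟩
    change φ.symm (rightMul v x) = rightMul (φ.symm v) (θ.symm x)
    rw [LinearIsometryEquiv.symm_apply_eq, h, φ.apply_symm_apply, θ.apply_symm_apply]

end Twisted

/-- `Sp(n)`: the quaternionic `n × n` matrices with `A* A = A A* = 1`. -/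
abbrev compactSp (n : ℕ) : Submonoid (Matrix (Fin n) (Fin n) ℍ[ℝ]) :=
  unitary (Matrix (Fin n) (Fin n) ℍ[ℝ])

/-- `Sp(1)`: the unit quaternions. -/
abbrev unitQuaternion : Submonoid ℍ[ℝ] := unitary ℍ[ℝ]

/-- The standard positive definite quadratic form `x₁² + ⋯ + x₇²` on `ℝ⁷`. -/
def euclideanForm7 : QuadraticForm ℝ (Fin 7 → ℝ) :=
  QuadraticMap.weightedSumSquares ℝ (fun _ : Fin 7 => (1 : ℝ))

/-- `Spin(7)`, inside the Clifford algebra of the Euclidean space `ℝ⁷`. -/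
abbrev Spin7 : Submonoid (CliffordAlgebra euclideanForm7) := spinGroup euclideanForm7

/-- `Spin(7)` lies in the even Clifford algebra. -/
def Spin7.toEven (s : Spin7) : CliffordAlgebra.even euclideanForm7 :=
  ⟨s, spinGroup.mem_even s.2⟩

end

/-! When `A` is associative and `n > 0`, cancelling a nonzero vector in `φ (v x) = φ(v) θ(x)` shows
that the twist `θ` is a unital ring endomorphism. Over `ℝ` it is trivial; over `ℂ` it is the
identity or conjugation, and the determinant excludes the latter. So `φ` is right `A`-linear, that
is, given by a matrix, which is unitary because the inverse of an isometry is its adjoint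
(`mem_range_unitaryMulVec`). Over `ℍ`, Skolem–Noether makes `θ` conjugation by a unit quaternion
`q`; right multiplication by `q` removes the twist and leaves an element of `Sp(n)`.

Over `𝕆`, right multiplications `γ(v)` by imaginary octonions satisfy `γ(v)² = -|v|²`, so
`-γ(v)γ(w)` defines a representation `Ψ` of the even Clifford algebra. If `s v = θ(v) s` in the
Clifford algebra, then `Ψ(s) γ(v) = γ(θ v) Ψ(s)` (`spinRep_mul_gamma`), which is the twisted
condition for `Ψ(s)` (`map_mul_iff_gamma`). Conversely, the twist of a given `φ` fixes `1` and
rotates `ℝ⁷`; writing it as a product of reflections lifts it to some `s` in `Spin(7)`. Then `Ψ(s)⁻¹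
φ` is right `𝕆`-linear, hence left multiplication by an element of the left nucleus `ℝ`, and so
`±1`; since `-1` lies in `Spin(7)`, the action is onto. It is faithful because an even element of
the Clifford algebra that commutes with all vectors is a scalar. -/

/-! ### Right-linear isometries are unitary matrices -/

section MatrixIsometries

/-- A right-linear map of `Aⁿ` is multiplication by the matrix of its values on basis vectors. -/
theorem eq_mulVec_of_rightMul {A : Type*} [NormedRing A] {n : ℕ}
    {φ : LinearSpaceOver A n → LinearSpaceOver A n}
    (hadd : ∀ u v, φ (u + v) = φ u + φ v)
    (hφ : ∀ v x, φ (rightMul v x) = rightMul (φ v) x) (v : LinearSpaceOver A n) :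
    φ v = WithLp.toLp 2
      ((Matrix.of fun i j => φ (WithLp.toLp 2 (Pi.single j (1 : A))) i) *ᵥ WithLp.ofLp v) := by
  have hv : v = ∑ j, rightMul (WithLp.toLp 2 (Pi.single j (1 : A))) (v j) := by
    ext i
    simp [rightMul, Pi.single_apply]
  conv_lhs => rw [hv]
  have hsum : ∀ f : Fin n → LinearSpaceOver A n, φ (∑ j, f j) = ∑ j, φ (f j) :=
    fun f => map_sum (AddMonoidHom.mk' φ hadd) f _
  rw [hsum]
  ext i
  simp only [hφ]
  simp [rightMul, Matrix.mulVec, dotProduct]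

variable {A : Type*} [NormedRing A] [StarRing A] [InnerProductSpace ℝ A]

/-- The inner product of `A` makes left multiplication by `star a` adjoint to left
multiplication by `a`. -/
class StarAdjoint (A : Type*) [NormedRing A] [StarRing A] [InnerProductSpace ℝ A] : Prop where
  inner_mul_left (a x y : A) : inner ℝ (a * x) y = inner ℝ x (star a * y)

instance : StarAdjoint ℝ where
  inner_mul_left a x y := by simp; ring

instance : StarAdjoint ℂ where
  inner_mul_left a x y := by
    simp only [Complex.inner, Complex.mul_re, Complex.mul_im, Complex.conj_re, Complex.conj_im,
      Complex.star_def, map_mul]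
    ring

instance : StarAdjoint ℍ[ℝ] where
  inner_mul_left a x y := by
    simp only [Quaternion.inner_def, Quaternion.re_mul, Quaternion.re_star, Quaternion.imI_star,
      Quaternion.imJ_star, Quaternion.imK_star, Quaternion.imI_mul, Quaternion.imJ_mul,
      Quaternion.imK_mul]
    ring

variable {n : ℕ}

theorem inner_mulVec_left [StarAdjoint A] (B : Matrix (Fin n) (Fin n) A)
    (u v : LinearSpaceOver A n) :
    inner ℝ (WithLp.toLp 2 (B *ᵥ WithLp.ofLp u) : LinearSpaceOver A n) v =
      inner ℝ u (WithLp.toLp 2 (Bᴴ *ᵥ WithLp.ofLp v) : LinearSpaceOver A n) := by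
  simp only [PiLp.inner_apply, Matrix.mulVec, dotProduct, sum_inner, inner_sum,
    Matrix.conjTranspose_apply, StarAdjoint.inner_mul_left]
  exact Finset.sum_comm

variable [SMulCommClass ℝ A A]

/-- Multiplication of column vectors by a unitary matrix, as a linear isometry. -/
noncomputable def unitaryMulVec [StarAdjoint A] :
    unitary (Matrix (Fin n) (Fin n) A) →* (LinearSpaceOver A n ≃ₗᵢ[ℝ] LinearSpaceOver A n) where
  toFun B :=
    { toFun := fun v => WithLp.toLp 2 (B.1 *ᵥ WithLp.ofLp v)
      invFun := fun v => WithLp.toLp 2 (B.1ᴴ *ᵥ WithLp.ofLp v)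
      map_add' := fun u v => by simp [Matrix.mulVec_add]
      map_smul' := fun r v => by simp [Matrix.mulVec_smul]
      left_inv := fun v => by
        simp [Matrix.mulVec_mulVec, ← Matrix.star_eq_conjTranspose, Unitary.star_mul_self_of_mem B.2]
      right_inv := fun v => by
        simp [Matrix.mulVec_mulVec, ← Matrix.star_eq_conjTranspose, Unitary.mul_star_self_of_mem B.2]
      norm_map' := fun v => by
        change ‖(WithLp.toLp 2 (B.1 *ᵥ WithLp.ofLp v) : LinearSpaceOver A n)‖ = ‖v‖
        rw [← sq_eq_sq₀ (norm_nonneg _) (norm_nonneg _), ← real_inner_self_eq_norm_sq,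
          ← real_inner_self_eq_norm_sq, inner_mulVec_left]
        simp [Matrix.mulVec_mulVec, ← Matrix.star_eq_conjTranspose,
          Unitary.star_mul_self_of_mem B.2] }
  map_one' := by ext v i; simp
  map_mul' B C := by
    ext v i
    change ((B.1 * C.1) *ᵥ WithLp.ofLp v) i = (B.1 *ᵥ (C.1 *ᵥ WithLp.ofLp v)) i
    rw [Matrix.mulVec_mulVec]

theorem unitaryMulVec_apply [StarAdjoint A] (B : unitary (Matrix (Fin n) (Fin n) A))
    (v : LinearSpaceOver A n) :
    unitaryMulVec B v = WithLp.toLp 2 (B.1 *ᵥ WithLp.ofLp v) := rfl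

theorem unitaryMulVec_injective [StarAdjoint A] :
    Function.Injective (unitaryMulVec (A := A) (n := n)) := by
  intro B C h
  refine Subtype.ext (Matrix.ext fun i j => ?_)
  have := congrArg (fun w : LinearSpaceOver A n => w i)
    (DFunLike.congr_fun h (WithLp.toLp 2 (Pi.single j 1)))
  simpa [unitaryMulVec_apply] using this

/-- A right-linear bijection and its inverse both have matrices. For an isometry the inverse is the
adjoint, so the matrix of the inverse is the conjugate transpose. -/
theorem mem_range_unitaryMulVec [StarAdjoint A]
    {φ : LinearSpaceOver A n ≃ₗᵢ[ℝ] LinearSpaceOver A n} :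
    φ ∈ (unitaryMulVec (A := A) (n := n)).range ↔
      ∀ v x, φ (rightMul v x) = rightMul (φ v) x := by
  constructor
  · rintro ⟨B, rfl⟩ v x
    ext i
    simp [unitaryMulVec_apply, rightMul, Matrix.mulVec, dotProduct, Finset.sum_mul, mul_assoc]
  · intro hφ
    have hψ : ∀ v x, φ.symm (rightMul v x) = rightMul (φ.symm v) x := fun v x => by
      rw [LinearIsometryEquiv.symm_apply_eq, hφ, φ.apply_symm_apply]
    set B : Matrix (Fin n) (Fin n) A :=
      Matrix.of fun i j => φ (WithLp.toLp 2 (Pi.single j (1 : A))) i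
    set C : Matrix (Fin n) (Fin n) A :=
      Matrix.of fun i j => φ.symm (WithLp.toLp 2 (Pi.single j (1 : A))) i
    have hB : ∀ v, φ v = WithLp.toLp 2 (B *ᵥ WithLp.ofLp v) :=
      eq_mulVec_of_rightMul (map_add φ) hφ
    have hC : ∀ v, φ.symm v = WithLp.toLp 2 (C *ᵥ WithLp.ofLp v) :=
      eq_mulVec_of_rightMul (map_add φ.symm) hψ
    have hCB : Bᴴ = C := by
      ext i j
      have key : ∀ v : LinearSpaceOver A n, (WithLp.toLp 2 (Bᴴ *ᵥ WithLp.ofLp v) :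
          LinearSpaceOver A n) = WithLp.toLp 2 (C *ᵥ WithLp.ofLp v) := fun v => by
        refine ext_inner_left ℝ fun u => ?_
        rw [← inner_mulVec_left, ← hB, ← hC, ← φ.inner_map_map u (φ.symm v), φ.apply_symm_apply]
      have := congrArg (fun w : LinearSpaceOver A n => w i)
        (key (WithLp.toLp 2 (Pi.single j 1)))
      simpa using this
    have h1 : C * B = 1 := by
      ext i j
      change (C *ᵥ B.col j) i = _
      have := congrArg (fun w : LinearSpaceOver A n => w i)
        (φ.symm_apply_apply (WithLp.toLp 2 (Pi.single j 1)))
      simpa [hB, hC, Matrix.mulVec_mulVec, Matrix.one_apply, Pi.single_apply] using this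
    have h2 : B * C = 1 := by
      ext i j
      change (B *ᵥ C.col j) i = _
      have := congrArg (fun w : LinearSpaceOver A n => w i)
        (φ.apply_symm_apply (WithLp.toLp 2 (Pi.single j 1)))
      simpa [hB, hC, Matrix.mulVec_mulVec, Matrix.one_apply, Pi.single_apply] using this
    refine ⟨⟨B, ?_⟩, ?_⟩
    · rw [Unitary.mem_iff, Matrix.star_eq_conjTranspose, hCB]
      exact ⟨h1, h2⟩
    · ext1 v
      rw [unitaryMulVec_apply, hB]

end MatrixIsometries

/-! ### The twist is a ring endomorphism -/

section Domain

variable {A : Type*} [NormedRing A] [NoZeroDivisors A] {n : ℕ}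

theorem rightMul_cancel {v : LinearSpaceOver A n} (hv : v ≠ 0) {x y : A}
    (h : rightMul v x = rightMul v y) : x = y := by
  obtain ⟨i, hi⟩ : ∃ i, v i ≠ 0 := by
    by_contra! h0
    exact hv (by ext i; exact h0 i)
  have := congrArg (fun w : LinearSpaceOver A n => w i) h
  have hxy : v i * (x - y) = 0 := by
    simpa [rightMul, mul_sub, sub_eq_zero] using this
  exact sub_eq_zero.1 ((mul_eq_zero.1 hxy).resolve_left hi)

variable [Nontrivial A] [InnerProductSpace ℝ A]

theorem twist_map_one [NeZero n] {φ : LinearSpaceOver A n ≃ₗᵢ[ℝ] LinearSpaceOver A n}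
    {θ : A ≃ₗᵢ[ℝ] A} (h : ∀ v x, φ (rightMul v x) = rightMul (φ v) (θ x)) : θ 1 = 1 := by
  obtain ⟨v, hv⟩ := exists_ne (0 : LinearSpaceOver A n)
  refine rightMul_cancel (v := φ v) (by simpa using hv) ?_
  rw [← h]
  simp [rightMul]

/-- Applying `φ` to `v (x y) = (v x) y` gives `φ(v) θ(x y) = φ(v) (θ(x) θ(y))`, and `φ(v)` cancels.
Associativity of `A` is essential. -/
theorem twist_map_mul [NeZero n] {φ : LinearSpaceOver A n ≃ₗᵢ[ℝ] LinearSpaceOver A n}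
    {θ : A ≃ₗᵢ[ℝ] A} (h : ∀ v x, φ (rightMul v x) = rightMul (φ v) (θ x)) (x y : A) :
    θ (x * y) = θ x * θ y := by
  obtain ⟨v, hv⟩ := exists_ne (0 : LinearSpaceOver A n)
  refine rightMul_cancel (v := φ v) (by simpa using hv) ?_
  have assoc : ∀ (w : LinearSpaceOver A n) (a b : A),
      rightMul w (a * b) = rightMul (rightMul w a) b := fun w a b => by
    ext i; simp [rightMul, mul_assoc]
  rw [← h, assoc, assoc, h, h]

end Domain

/-! ### The real and complex cases -/

section RealComplex

/-- If the twist of every element of `G_A(n)`, `n > 0`, is trivial, then `G_A(n)` is the unitary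
group. -/
theorem exists_twistedIso_equiv_unitary {A : Type*} [NormedRing A] [NoZeroDivisors A]
    [Nontrivial A] [StarRing A] [InnerProductSpace ℝ A] [SMulCommClass ℝ A A] [StarAdjoint A]
    (hA : ∀ θ ∈ specialOrthogonal A, θ 1 = 1 → θ = 1) (n : ℕ) :
    ∃ e : twistedIso A n ≃* unitary (Matrix (Fin n) (Fin n) A),
      ∀ (φ : twistedIso A n) (v : LinearSpaceOver A n),
        φ.1 v = WithLp.toLp 2 ((e φ).1 *ᵥ WithLp.ofLp v) := by
  have hrange : (unitaryMulVec (A := A) (n := n)).range = twistedIso A n := by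
    ext φ
    rw [mem_range_unitaryMulVec]
    constructor
    · exact fun h => ⟨1, one_mem _, h⟩
    · rintro ⟨θ, hθ, h⟩ v x
      -- For `n = 0` the twist is unconstrained, but the module is zero and there is nothing to
      -- prove.
      rcases Nat.eq_zero_or_pos n with rfl | hn
      · exact Subsingleton.elim _ _
      · have : NeZero n := ⟨hn.ne'⟩
        rw [h, hA θ hθ (twist_map_one h)]
        rfl
  let e := (MonoidHom.ofInjective (unitaryMulVec_injective (A := A) (n := n))).trans
    (MulEquiv.subgroupCongr hrange)
  refine ⟨e.symm, fun φ v => ?_⟩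
  rw [← unitaryMulVec_apply]
  exact congrArg (fun ψ : twistedIso A n => ψ.1 v) (e.apply_symm_apply φ).symm

theorem real_isometry_eq_one (θ : ℝ ≃ₗᵢ[ℝ] ℝ) (h : θ 1 = 1) : θ = 1 := by
  ext x
  have := θ.map_smul x 1
  simpa [h] using this

theorem complex_rotation_eq_one (θ : ℂ ≃ₗᵢ[ℝ] ℂ) (hθ : θ ∈ specialOrthogonal ℂ)
    (h : θ 1 = 1) : θ = 1 := by
  rcases linear_isometry_complex_aux h with rfl | rfl
  · rfl
  · have h1 : LinearMap.det (Complex.conjLIE.toLinearEquiv : ℂ →ₗ[ℝ] ℂ) = 1 := hθ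
    have h2 := Complex.det_conjAe
    have h3 : LinearMap.det (Complex.conjLIE.toLinearEquiv : ℂ →ₗ[ℝ] ℂ) = -1 := h2
    norm_num [h3] at h1

end RealComplex

/-! ### Endomorphisms of the quaternions are inner -/

section QuaternionAutomorphisms

/-- Both sides equal `a + c`. Thus `1 - a c` intertwines two square roots of `-1`, and it vanishes
only if `a = -c`. -/
theorem one_sub_mul_conj {R : Type*} [Ring R] {a c : R} (ha : a * a = -1) (hc : c * c = -1) :
    a * (1 - a * c) = (1 - a * c) * c := by
  rw [mul_sub, sub_mul, ← mul_assoc, ha, mul_assoc a c c, hc]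
  simp [add_comm]

theorem eq_neg_of_one_sub_mul_eq_zero {R : Type*} [Ring R] {a c : R} (hc : c * c = -1)
    (h : 1 - a * c = 0) : a = -c := by
  have : a * c = 1 := (sub_eq_zero.1 h).symm
  calc a = -(a * (c * c)) := by rw [hc]; simp
    _ = -c := by rw [← mul_assoc, this, one_mul]

/-- The quaternion `a + b i + c j + d k`. -/
def quat (a b c d : ℝ) : ℍ[ℝ] := ⟨a, b, c, d⟩

section
variable (a b c d : ℝ)
@[simp] theorem re_quat : (quat a b c d).re = a := rfl
@[simp] theorem imI_quat : (quat a b c d).imI = b := rfl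
@[simp] theorem imJ_quat : (quat a b c d).imJ = c := rfl
@[simp] theorem imK_quat : (quat a b c d).imK = d := rfl
end

theorem quaternion_decomp (x : ℍ[ℝ]) :
    x = x.re • (1 : ℍ[ℝ]) + x.imI • quat 0 1 0 0 + x.imJ • quat 0 0 1 0 +
      x.imK • (quat 0 1 0 0 * quat 0 0 1 0) := by
  ext <;> simp

/-- **Skolem–Noether** for the quaternions. -/
theorem exists_conj_of_quaternion_hom (θ : ℍ[ℝ] →ₗ[ℝ] ℍ[ℝ]) (h1 : θ 1 = 1)
    (hmul : ∀ x y, θ (x * y) = θ x * θ y) : ∃ q : ℍ[ℝ], q ≠ 0 ∧ ∀ x, θ x * q = q * x := by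
  set i : ℍ[ℝ] := quat 0 1 0 0 with hi
  set j : ℍ[ℝ] := quat 0 0 1 0 with hj
  have hii : i * i = -1 := by ext <;> simp [hi]
  have hjj : j * j = -1 := by ext <;> simp [hj]
  have hji : j * i = -(i * j) := by ext <;> simp [hi, hj]
  have hi0 : i ≠ 0 := fun h => by simpa [hi] using congrArg (fun y : ℍ[ℝ] => y.imI) h
  have hj0 : j ≠ 0 := fun h => by simpa [hj] using congrArg (fun y : ℍ[ℝ] => y.imJ) h
  -- First match `θ i` with `i`: take `1 - θ(i) i`, or `j` in the degenerate case `θ i = -i`.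
  obtain ⟨p, hp0, hp⟩ : ∃ p : ℍ[ℝ], p ≠ 0 ∧ θ i * p = p * i := by
    have ha : θ i * θ i = -1 := by rw [← hmul, hii, map_neg, h1]
    by_cases h : 1 - θ i * i = 0
    · refine ⟨j, hj0, ?_⟩
      rw [eq_neg_of_one_sub_mul_eq_zero hii h, hji, neg_mul]
    · exact ⟨_, h, one_sub_mul_conj ha hii⟩
  -- After undoing `p`, the image `b` of `j` still squares to `-1` and anticommutes with `i`.
  set b := p⁻¹ * θ j * p with hb
  have hpb : θ j * p = p * b := by
    rw [hb, ← mul_assoc, ← mul_assoc, mul_inv_cancel₀ hp0, one_mul]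
  have hθi : θ i = p * i * p⁻¹ := by rw [← hp, mul_assoc, mul_inv_cancel₀ hp0, mul_one]
  have hθj : θ j = p * b * p⁻¹ := by rw [← hpb, mul_assoc, mul_inv_cancel₀ hp0, mul_one]
  have cancel : ∀ u v : ℍ[ℝ], (p * u * p⁻¹) * (p * v * p⁻¹) = p * (u * v) * p⁻¹ := fun u v => by
    calc (p * u * p⁻¹) * (p * v * p⁻¹) = p * u * (p⁻¹ * p) * v * p⁻¹ := by noncomm_ring
      _ = p * (u * v) * p⁻¹ := by rw [inv_mul_cancel₀ hp0]; noncomm_ring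
  clear_value b
  have hpi0 : p⁻¹ ≠ 0 := inv_ne_zero hp0
  have hbb : b * b = -1 := by
    have h : θ j * θ j = -1 := by rw [← hmul, hjj, map_neg, h1]
    rw [hθj, cancel] at h
    have h' : p * (b * b) * p⁻¹ = p * (-1) * p⁻¹ := by
      rw [h, mul_neg, mul_one, neg_mul, mul_inv_cancel₀ hp0]
    exact mul_left_cancel₀ hp0 (mul_right_cancel₀ hpi0 h')
  have hbi : b * i = -(i * b) := by
    have h : θ j * θ i = -(θ i * θ j) := by rw [← hmul, ← hmul, hji, map_neg]
    rw [hθi, hθj, cancel, cancel] at h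
    have h' : p * (b * i) * p⁻¹ = p * (-(i * b)) * p⁻¹ := by rw [h, mul_neg, neg_mul]
    exact mul_left_cancel₀ hp0 (mul_right_cancel₀ hpi0 h')
  -- The intertwiner `1 - b j` of `b` and `j` commutes with `i`, because `b` and `j` both
  -- anticommute with it; so correcting `j` does not disturb `i`. If `b = -j`, then `i` itself
  -- serves.
  obtain ⟨r, hr0, hrj, hri⟩ : ∃ r : ℍ[ℝ], r ≠ 0 ∧ b * r = r * j ∧ i * r = r * i := by
    by_cases h : 1 - b * j = 0
    · refine ⟨i, hi0, ?_, rfl⟩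
      rw [eq_neg_of_one_sub_mul_eq_zero hjj h, neg_mul, hji, neg_neg]
    · refine ⟨_, h, one_sub_mul_conj hbb hjj, ?_⟩
      rw [mul_sub, sub_mul, mul_one, one_mul, mul_assoc b j i, hji, mul_neg, ← mul_assoc b i,
        hbi, neg_mul, neg_neg, mul_assoc]
  have hqi : θ i * (p * r) = p * r * i := by rw [← mul_assoc, hp, mul_assoc, hri, mul_assoc]
  have hqj : θ j * (p * r) = p * r * j := by rw [← mul_assoc, hpb, mul_assoc, hrj, mul_assoc]
  refine ⟨p * r, mul_ne_zero hp0 hr0, fun x => ?_⟩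
  rw [quaternion_decomp x, ← hi, ← hj]
  simp only [map_add, map_smul, h1, hmul, add_mul, mul_add, smul_mul_assoc, mul_smul_comm, hqi,
    hqj, mul_one, one_mul, mul_assoc (θ i) (θ j)]
  rw [← mul_assoc (θ i), hqi, mul_assoc (p * r) i j]

/-- Conjugation `x ↦ q x q⁻¹` by a nonzero quaternion. -/
noncomputable def quaternionConj (q : ℍ[ℝ]) (hq : q ≠ 0) : ℍ[ℝ] ≃ₗᵢ[ℝ] ℍ[ℝ] where
  toFun x := q * x * q⁻¹
  invFun x := q⁻¹ * x * q
  map_add' x y := by rw [mul_add, add_mul]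
  map_smul' r x := by simp
  left_inv x := by simp [mul_assoc, hq]
  right_inv x := by simp [mul_assoc, hq]
  norm_map' x := by
    change ‖q * x * q⁻¹‖ = ‖x‖
    rw [norm_mul, norm_mul, norm_inv]
    field_simp [norm_ne_zero_iff.2 hq]

theorem quaternionConj_apply (q : ℍ[ℝ]) (hq : q ≠ 0) (x : ℍ[ℝ]) :
    quaternionConj q hq x = q * x * q⁻¹ := rfl

theorem quaternionConj_mem_specialOrthogonal (q : ℍ[ℝ]) (hq : q ≠ 0) :
    quaternionConj q hq ∈ specialOrthogonal ℍ[ℝ] := by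
  let s : ℍ[ℝ] ≃ₗ[ℝ] ℍ[ℝ] := LinearEquiv.ofInvolutive
    { toFun := star, map_add' := star_add, map_smul' := fun r x => by ext <;> simp } star_star
  -- Right multiplication by `star q` is left multiplication by `q` conjugated by `star`, so both
  -- have the same determinant and the total is a square. A nonnegative determinant of an isometry
  -- is `1`.
  have hdet : LinearMap.det ((quaternionConj q hq).toLinearEquiv : ℍ[ℝ] →ₗ[ℝ] ℍ[ℝ]) =
      (Quaternion.normSq q ^ 2)⁻¹ ^ 2 * LinearMap.det (LinearMap.mulLeft ℝ q) ^ 2 := by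
    have h : ((quaternionConj q hq).toLinearEquiv : ℍ[ℝ] →ₗ[ℝ] ℍ[ℝ]) =
        (Quaternion.normSq q)⁻¹ • LinearMap.mulLeft ℝ q ∘ₗ
          ((s : ℍ[ℝ] →ₗ[ℝ] ℍ[ℝ]) ∘ₗ LinearMap.mulLeft ℝ q ∘ₗ (s.symm : ℍ[ℝ] →ₗ[ℝ] ℍ[ℝ])) := by
      ext1 x
      change q * x * q⁻¹ = (Quaternion.normSq q)⁻¹ • (q * star (q * star x))
      rw [star_mul, star_star, ← mul_assoc, Quaternion.inv_def, mul_smul_comm]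
    rw [h, LinearMap.det_smul, LinearMap.det_comp, LinearMap.det_conj, Quaternion.finrank_eq_four]
    ring
  have hnonneg : 0 ≤ LinearMap.det ((quaternionConj q hq).toLinearEquiv : ℍ[ℝ] →ₗ[ℝ] ℍ[ℝ]) := by
    rw [hdet]; positivity
  change LinearMap.det ((quaternionConj q hq).toLinearEquiv : ℍ[ℝ] →ₗ[ℝ] ℍ[ℝ]) = 1
  rw [← abs_of_nonneg hnonneg, ← LinearMap.normDet_eq_abs_det]
  exact LinearIsometry.normDet_eq_one (quaternionConj q hq).toLinearIsometry

theorem quaternion_eq_re_of_commute {q : ℍ[ℝ]} (h : ∀ x, q * x = x * q) : q = (q.re : ℍ[ℝ]) := by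
  have hi := h (quat 0 1 0 0)
  have hj := h (quat 0 0 1 0)
  have h1 := congrArg (fun y : ℍ[ℝ] => y.imK) hi
  have h2 := congrArg (fun y : ℍ[ℝ] => y.imJ) hi
  have h3 := congrArg (fun y : ℍ[ℝ] => y.imK) hj
  simp at h1 h2 h3
  ext
  · simp
  all_goals simp only [Quaternion.imI_coe, Quaternion.imJ_coe, Quaternion.imK_coe]; linarith

end QuaternionAutomorphisms

/-! ### The quaternionic case -/

section Symplectic

variable {n : ℕ}

theorem unitQuaternion_ne_zero (q : unitQuaternion) : q.1 ≠ 0 := by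
  intro h
  have := Unitary.star_mul_self_of_mem q.2
  simp [h] at this

theorem unitQuaternion_norm (q : unitQuaternion) : ‖q.1‖ = 1 :=
  CStarRing.norm_of_mem_unitary q.2

/-- Right multiplication of `ℍⁿ` by the inverse of a unit quaternion. -/
noncomputable def rightMulInv (n : ℕ) : unitQuaternion →*
    (LinearSpaceOver ℍ[ℝ] n ≃ₗᵢ[ℝ] LinearSpaceOver ℍ[ℝ] n) where
  toFun q :=
    { toFun := fun v => rightMul v (q.1)⁻¹
      invFun := fun v => rightMul v q.1
      map_add' := fun u v => by ext1 i; simp [rightMul, add_mul]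
      map_smul' := fun r v => by ext1 i; simp [rightMul]
      left_inv := fun v => by ext1 i; simp [rightMul, unitQuaternion_ne_zero q]
      right_inv := fun v => by ext1 i; simp [rightMul, unitQuaternion_ne_zero q]
      norm_map' := fun v => by
        change ‖rightMul v (q.1)⁻¹‖ = ‖v‖
        simp [PiLp.norm_eq_of_L2, rightMul, unitQuaternion_norm q] }
  map_one' := by ext1 v; ext1 i; simp [rightMul]
  map_mul' p q := by
    ext1 v; ext1 i
    change v i * (p.1 * q.1)⁻¹ = v i * (q.1)⁻¹ * (p.1)⁻¹
    rw [mul_inv_rev, mul_assoc]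

theorem unitaryMulVec_commute_rightMulInv (B : compactSp n) (q : unitQuaternion) :
    Commute (unitaryMulVec B) (rightMulInv n q) := by
  ext1 v
  exact mem_range_unitaryMulVec.1 ⟨B, rfl⟩ v _

/-- The action `(B, q) ↦ (v ↦ B v q⁻¹)` of `Sp(n) × Sp(1)` on `ℍⁿ`. -/
noncomputable def spAction (n : ℕ) : compactSp n × unitQuaternion →*
    (LinearSpaceOver ℍ[ℝ] n ≃ₗᵢ[ℝ] LinearSpaceOver ℍ[ℝ] n) where
  toFun x := rightMulInv n x.2 * unitaryMulVec x.1
  map_one' := by simp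
  map_mul' x y := by
    simp only [Prod.fst_mul, Prod.snd_mul, map_mul]
    rw [mul_assoc, mul_assoc, ← mul_assoc (rightMulInv n y.2), ← mul_assoc (unitaryMulVec x.1),
      ← (unitaryMulVec_commute_rightMulInv x.1 y.2).eq, mul_assoc]

theorem spAction_apply (B : compactSp n) (q : unitQuaternion) (v : LinearSpaceOver ℍ[ℝ] n) :
    spAction n (B, q) v = rightMul (WithLp.toLp 2 (B.1 *ᵥ WithLp.ofLp v)) (q.1)⁻¹ := rfl

/-- Since `B (v x) q⁻¹ = (B v q⁻¹)(q x q⁻¹)`, the twist is conjugation by `q`. Conversely,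
conjugation by `q` is the only kind of twist, and right multiplication by `q` undoes it. -/
theorem range_spAction (n : ℕ) : (spAction n).range = twistedIso ℍ[ℝ] n := by
  ext φ
  constructor
  · rintro ⟨⟨B, q⟩, rfl⟩
    refine ⟨_, quaternionConj_mem_specialOrthogonal q.1 (unitQuaternion_ne_zero q), fun v x => ?_⟩
    have h := mem_range_unitaryMulVec.1 ⟨B, rfl⟩ v x
    rw [unitaryMulVec_apply, unitaryMulVec_apply] at h
    rw [spAction_apply, spAction_apply, h, quaternionConj_apply]
    ext1 i
    simp [rightMul, mul_assoc, unitQuaternion_ne_zero q]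
  · rintro ⟨θ, hθ, h⟩
    rcases Nat.eq_zero_or_pos n with rfl | hn
    · exact ⟨1, LinearIsometryEquiv.ext fun v => Subsingleton.elim _ _⟩
    have : NeZero n := ⟨hn.ne'⟩
    obtain ⟨p, hp0, hp⟩ := exists_conj_of_quaternion_hom (θ.toLinearEquiv : ℍ[ℝ] →ₗ[ℝ] ℍ[ℝ])
      (twist_map_one h) (twist_map_mul h)
    replace hp : ∀ x, θ x * p = p * x := hp
    have hpn : ‖p‖ ≠ 0 := norm_ne_zero_iff.2 hp0
    -- Conjugation is unaffected by real scaling, so the conjugating quaternion may be normalised.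
    have hq : ‖p‖⁻¹ • p ∈ unitary ℍ[ℝ] := by
      have h1 : Quaternion.normSq (‖p‖⁻¹ • p) = 1 := by
        rw [Quaternion.normSq_eq_norm_mul_self, norm_smul]
        simp [hpn]
      rw [Unitary.mem_iff, Quaternion.star_mul_self, Quaternion.self_mul_star, h1]
      simp
    let q : unitQuaternion := ⟨‖p‖⁻¹ • p, hq⟩
    have hq0 := unitQuaternion_ne_zero q
    have hθq : ∀ x, θ x * q.1 = q.1 * x := fun x => by
      simp only [q, mul_smul_comm, smul_mul_assoc, hp]
    obtain ⟨B, hB⟩ := mem_range_unitaryMulVec (φ := (rightMulInv n q)⁻¹ * φ) |>.2 fun v x => by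
      change (rightMulInv n q).symm (φ (rightMul v x)) =
        rightMul ((rightMulInv n q).symm (φ v)) x
      rw [h]
      change rightMul (rightMul (φ v) (θ x)) q.1 = rightMul (rightMul (φ v) q.1) x
      ext1 i
      simp only [rightMul, mul_assoc, hθq]
    refine ⟨(B, q), ?_⟩
    change rightMulInv n q * unitaryMulVec B = φ
    rw [hB, mul_inv_cancel_left]

/-- Testing on basis vectors times `1` gives `B = q · 1`. Testing on multiples of a basis vector,
which needs `n > 0`, shows that `q` is central, hence a real number of norm one. -/
theorem mem_ker_spAction (hn : 0 < n) (B : compactSp n) (q : unitQuaternion) :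
    (B, q) ∈ (spAction n).ker ↔ (B.1 = 1 ∧ q.1 = 1) ∨ (B.1 = -1 ∧ q.1 = -1) := by
  have hq0 := unitQuaternion_ne_zero q
  rw [MonoidHom.mem_ker]
  constructor
  · intro h
    have key : ∀ (j i : Fin n) (x : ℍ[ℝ]), B.1 i j * x = Pi.single (M := fun _ => ℍ[ℝ]) j x i * q.1 :=
      fun j i x => by
        have := congrArg (fun w : LinearSpaceOver ℍ[ℝ] n => w i)
          (DFunLike.congr_fun h (WithLp.toLp 2 (Pi.single j x)))
        rw [spAction_apply] at this
        have h' : B.1 i j * x * (q.1)⁻¹ = Pi.single (M := fun _ => ℍ[ℝ]) j x i := by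
          simpa [rightMul, Pi.single_apply] using this
        rw [← h', mul_assoc, inv_mul_cancel₀ hq0, mul_one]
    have hBq : ∀ i j, B.1 i j = if i = j then q.1 else 0 := fun i j => by
      have := key j i 1
      rw [mul_one, Pi.single_apply] at this
      rw [this]; split_ifs <;> simp
    have hcomm : ∀ x, q.1 * x = x * q.1 := fun x => by
      have := key ⟨0, hn⟩ ⟨0, hn⟩ x
      simpa [hBq] using this
    have hre := quaternion_eq_re_of_commute hcomm
    have hnorm := unitQuaternion_norm q
    rw [hre, Quaternion.norm_coe, Real.norm_eq_abs] at hnorm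
    rcases eq_or_eq_neg_of_abs_eq hnorm with h1 | h1
    · rw [h1] at hre
      refine Or.inl ⟨?_, by simpa using hre⟩
      ext1 i j
      rw [hBq, hre, Matrix.one_apply]; simp
    · rw [h1] at hre
      refine Or.inr ⟨?_, by simpa using hre⟩
      ext1 i j
      rw [hBq, hre, Matrix.neg_apply, Matrix.one_apply]; split_ifs <;> simp
  · rintro (⟨hB, hq⟩ | ⟨hB, hq⟩) <;> ext1 v <;> rw [spAction_apply, hB, hq] <;> ext1 i
    · simp [rightMul]
    · simp [rightMul, Matrix.neg_mulVec, inv_neg]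

end Symplectic

/-! ### Octonion arithmetic and imaginary octonions -/

namespace Octonion

@[simp] theorem fst_mk (a b : ℍ[ℝ]) : (mk a b).fst = a := rfl
@[simp] theorem snd_mk (a b : ℍ[ℝ]) : (mk a b).snd = b := rfl

@[ext] theorem ext {x y : Octonion} (h₁ : x.fst = y.fst) (h₂ : x.snd = y.snd) : x = y :=
  (WithLp.ofLp_injective 2) (Prod.ext h₁ h₂)

@[simp] theorem fst_add (x y : Octonion) : (x + y).fst = x.fst + y.fst := rfl
@[simp] theorem snd_add (x y : Octonion) : (x + y).snd = x.snd + y.snd := rfl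
@[simp] theorem fst_smul (r : ℝ) (x : Octonion) : (r • x).fst = r • x.fst := rfl
@[simp] theorem snd_smul (r : ℝ) (x : Octonion) : (r • x).snd = r • x.snd := rfl
@[simp] theorem fst_mul (x y : Octonion) :
    (x * y).fst = x.fst * y.fst - y.snd * star x.snd := rfl
@[simp] theorem snd_mul (x y : Octonion) :
    (x * y).snd = star x.fst * y.snd + y.fst * x.snd := rfl

noncomputable instance : One Octonion := ⟨mk 1 0⟩

@[simp] theorem fst_one : (1 : Octonion).fst = 1 := rfl
@[simp] theorem snd_one : (1 : Octonion).snd = 0 := rfl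

protected theorem mul_one (x : Octonion) : x * 1 = x := by ext1 <;> simp
protected theorem one_mul (x : Octonion) : 1 * x = x := by ext1 <;> simp

theorem inner_eq (x y : Octonion) :
    inner ℝ x y = inner ℝ x.fst y.fst + inner ℝ x.snd y.snd :=
  WithLp.prod_inner_apply x y

theorem inner_eq_sum (x y : Octonion) : inner ℝ x y =
    x.fst.re * y.fst.re + x.fst.imI * y.fst.imI + x.fst.imJ * y.fst.imJ + x.fst.imK * y.fst.imK +
    (x.snd.re * y.snd.re + x.snd.imI * y.snd.imI + x.snd.imJ * y.snd.imJ +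
      x.snd.imK * y.snd.imK) := by
  simp [inner_eq, Quaternion.inner_def]

theorem inner_one_left (x : Octonion) : inner ℝ (1 : Octonion) x = x.fst.re := by
  simp [inner_eq_sum]

protected theorem norm_one : ‖(1 : Octonion)‖ = 1 := by
  rw [norm_eq_sqrt_real_inner, inner_one_left]; simp

protected theorem one_ne_zero : (1 : Octonion) ≠ 0 := fun h => by
  have := Octonion.norm_one
  rw [h, norm_zero] at this
  exact zero_ne_one this

instance : FiniteDimensional ℝ Octonion :=
  inferInstanceAs (FiniteDimensional ℝ (WithLp 2 (ℍ[ℝ] × ℍ[ℝ])))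

theorem finrank_eq_eight : Module.finrank ℝ Octonion = 8 := by
  have h : Module.finrank ℝ (WithLp 2 (ℍ[ℝ] × ℍ[ℝ])) = Module.finrank ℝ (ℍ[ℝ] × ℍ[ℝ]) :=
    (WithLp.linearEquiv 2 ℝ (ℍ[ℝ] × ℍ[ℝ])).finrank_eq
  rw [Module.finrank_prod, Quaternion.finrank_eq_four] at h
  exact h

/-- Right multiplication, as a linear map `𝕆 → End 𝕆`. -/
noncomputable def rmul : Octonion →ₗ[ℝ] Module.End ℝ Octonion :=
  LinearMap.mk₂ ℝ (fun x y => y * x)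
    (fun x x' y => by ext1 <;> simp [mul_add, add_mul] <;> abel)
    (fun r x y => by ext1 <;> simp [smul_sub])
    (fun x y y' => by ext1 <;> simp [mul_add, add_mul] <;> abel)
    (fun r x y => by ext1 <;> simp [smul_sub])

theorem rmul_apply (x y : Octonion) : rmul x y = y * x := rfl

theorem rmul_one : rmul 1 = 1 := LinearMap.ext Octonion.mul_one

/-- This is the eight-square identity. It replaces associative cancellation: `𝕆` has no zero
divisors. -/
theorem inner_mul_self (x y : Octonion) :
    inner ℝ (y * x) (y * x) = inner ℝ y y * inner ℝ x x := by
  simp only [inner_eq_sum, fst_mul, snd_mul, Quaternion.re_mul, Quaternion.imI_mul,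
    Quaternion.imJ_mul, Quaternion.imK_mul, Quaternion.re_star, Quaternion.imI_star,
    Quaternion.imJ_star, Quaternion.imK_star, Quaternion.re_sub, Quaternion.imI_sub,
    Quaternion.imJ_sub, Quaternion.imK_sub, Quaternion.re_add, Quaternion.imI_add,
    Quaternion.imJ_add, Quaternion.imK_add]
  ring

protected theorem mul_left_cancel {a x y : Octonion} (ha : a ≠ 0) (h : a * x = a * y) : x = y := by
  have h0 : a * (x - y) = 0 := by
    rw [← rmul_apply, map_sub, LinearMap.sub_apply, rmul_apply, rmul_apply, h, sub_self]
  have := inner_mul_self (x - y) a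
  rw [h0, inner_zero_left, eq_comm, mul_eq_zero, inner_self_eq_zero, inner_self_eq_zero] at this
  exact sub_eq_zero.1 (this.resolve_left ha)

/-- Right multiplication by an imaginary octonion is skew-adjoint. -/
theorem inner_rmul_left {u : Octonion} (hu : u.fst.re = 0) (y z : Octonion) :
    inner ℝ (rmul u y) z = -inner ℝ y (rmul u z) := by
  simp only [rmul_apply, inner_eq_sum, fst_mul, snd_mul, Quaternion.re_mul, Quaternion.imI_mul,
    Quaternion.imJ_mul, Quaternion.imK_mul, Quaternion.re_star, Quaternion.imI_star,
    Quaternion.imJ_star, Quaternion.imK_star, Quaternion.re_sub, Quaternion.imI_sub,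
    Quaternion.imJ_sub, Quaternion.imK_sub, Quaternion.re_add, Quaternion.imI_add,
    Quaternion.imJ_add, Quaternion.imK_add, hu]
  ring

/-- This is the Clifford relation for right multiplications, the source of the spin representation;
it combines right alternativity with `u² = -|u|²`. -/
theorem rmul_mul_self {u : Octonion} (hu : u.fst.re = 0) :
    rmul u * rmul u = -(inner ℝ u u) • (1 : Module.End ℝ Octonion) := by
  ext1 y
  change (y * u) * u = -(inner ℝ u u) • y
  ext <;>
  · simp only [inner_eq_sum, fst_mul, snd_mul, fst_smul, snd_smul, Quaternion.re_mul,
      Quaternion.imI_mul, Quaternion.imJ_mul, Quaternion.imK_mul, Quaternion.re_star,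
      Quaternion.imI_star, Quaternion.imJ_star, Quaternion.imK_star, Quaternion.re_sub,
      Quaternion.imI_sub, Quaternion.imJ_sub, Quaternion.imK_sub, Quaternion.re_add,
      Quaternion.imI_add, Quaternion.imJ_add, Quaternion.imK_add, Quaternion.re_smul,
      Quaternion.imI_smul, Quaternion.imJ_smul, Quaternion.imK_smul, smul_eq_mul, hu]
    ring

/-- The left nucleus of the octonions is `ℝ`. -/
theorem eq_smul_one_of_left_nucleus {a : Octonion} (h : ∀ x y, a * (x * y) = (a * x) * y) :
    a = a.fst.re • (1 : Octonion) := by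
  -- With `a = (p, q)`, the pair `i, j` gives `k q = -k q`, so `q = 0`. The pairs `i, (0, 1)` and
  -- `j, (0, 1)` make `star p` commute with `i` and `j`, so `p` is real.
  have h₁ := congrArg snd (h (mk (quat 0 1 0 0) 0) (mk (quat 0 0 1 0) 0))
  have h₂ := congrArg snd (h (mk (quat 0 1 0 0) 0) (mk 0 1))
  have h₃ := congrArg snd (h (mk (quat 0 0 1 0) 0) (mk 0 1))
  rw [Quaternion.ext_iff] at h₁ h₂ h₃
  simp at h₁ h₂ h₃
  obtain ⟨h₁₁, h₁₂, h₁₃, h₁₄⟩ := h₁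
  obtain ⟨h₂₁, h₂₂⟩ := h₂
  ext <;> simp <;> linarith

/-- The imaginary octonions, parametrised by `ℝ⁷`. -/
def im : (Fin 7 → ℝ) →ₗ[ℝ] Octonion where
  toFun v := mk (quat 0 (v 0) (v 1) (v 2)) (quat (v 3) (v 4) (v 5) (v 6))
  map_add' v w := by ext <;> simp
  map_smul' r v := by ext <;> simp

/-- The coordinates of the imaginary part of an octonion. -/
def imCoord : Octonion →ₗ[ℝ] (Fin 7 → ℝ) where
  toFun x := ![x.fst.imI, x.fst.imJ, x.fst.imK, x.snd.re, x.snd.imI, x.snd.imJ, x.snd.imK]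
  map_add' x y := by ext i; fin_cases i <;> simp
  map_smul' r x := by ext i; fin_cases i <;> simp

@[simp] theorem re_fst_im (v : Fin 7 → ℝ) : (im v).fst.re = 0 := rfl

@[simp] theorem imCoord_im (v : Fin 7 → ℝ) : imCoord (im v) = v := by
  ext i; fin_cases i <;> rfl

theorem im_imCoord {x : Octonion} (hx : x.fst.re = 0) : im (imCoord x) = x := by
  ext <;> simp [im, imCoord, hx]

theorem eq_re_add_im (x : Octonion) : x = x.fst.re • (1 : Octonion) + im (imCoord x) := by
  ext <;> simp [im, imCoord]

theorem inner_im_im (v w : Fin 7 → ℝ) : inner ℝ (im v) (im w) = ∑ i, v i * w i := by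
  simp only [inner_eq_sum, Fin.sum_univ_seven]
  simp [im]
  ring

theorem euclideanForm7_apply (v : Fin 7 → ℝ) : euclideanForm7 v = inner ℝ (im v) (im v) := by
  rw [inner_im_im]
  simp [euclideanForm7, QuadraticMap.weightedSumSquares_apply]

theorem polar_euclideanForm7 (v w : Fin 7 → ℝ) :
    QuadraticMap.polar euclideanForm7 v w = 2 * inner ℝ (im v) (im w) := by
  simp only [QuadraticMap.polar, euclideanForm7_apply, map_add, inner_add_left, inner_add_right,
    real_inner_comm (im v) (im w)]
  ring

/-- Isometries fixing `1` preserve the imaginary octonions. -/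
theorem re_fst_map_im {θ : Octonion ≃ₗᵢ[ℝ] Octonion} (h : θ 1 = 1) (v : Fin 7 → ℝ) :
    (θ (im v)).fst.re = 0 := by
  rw [← inner_one_left, ← h, θ.inner_map_map, inner_one_left, re_fst_im]

theorem ext_of_im {θ η : Octonion ≃ₗᵢ[ℝ] Octonion} (h₁ : θ 1 = η 1)
    (h : ∀ v, θ (im v) = η (im v)) : θ = η := by
  ext1 x
  rw [eq_re_add_im x, map_add, map_add, map_smul, map_smul, h₁, h]

end Octonion

/-! ### Ordered products of anticommuting elements -/

section AnticommutingProducts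

variable {A : Type*} [Ring A] [Algebra ℝ A]

/-- The span of the ordered products of an even (`b = true`) or odd (`b = false`) number of
members of a list. -/
def productSpan : List A → Bool → Submodule ℝ A
  | [], b => if b then 1 else ⊥
  | a :: l, b => productSpan l b ⊔ (productSpan l !b).map (LinearMap.mulRight ℝ a)

theorem mem_productSpan_cons {a : A} {l : List A} {b : Bool} {x : A} :
    x ∈ productSpan (a :: l) b ↔
      ∃ y ∈ productSpan l b, ∃ z ∈ productSpan l !b, x = y + z * a := by
  simp only [productSpan, Submodule.mem_sup, Submodule.mem_map, LinearMap.mulRight_apply]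
  constructor
  · rintro ⟨y, hy, _, ⟨z, hz, rfl⟩, rfl⟩
    exact ⟨y, hy, z, hz, rfl⟩
  · rintro ⟨y, hy, z, hz, rfl⟩
    exact ⟨y, hy, _, ⟨z, hz, rfl⟩, rfl⟩

/-- Each factor passed contributes a sign, so only the parity of their number matters. -/
theorem mul_comm_of_mem_productSpan {a : A} {l : List A} (h : ∀ c ∈ l, a * c = -(c * a))
    {b : Bool} {x : A} (hx : x ∈ productSpan l b) :
    a * x = (if b then (1 : ℝ) else -1) • (x * a) := by
  induction l generalizing b x with
  | nil =>
    cases b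
    · have : x = 0 := by simpa [productSpan] using hx
      simp [this]
    · obtain ⟨r, rfl⟩ := Submodule.mem_one.1 (by simpa [productSpan] using hx)
      simp [Algebra.commutes]
  | cons c l ih =>
    obtain ⟨y, hy, z, hz, rfl⟩ := mem_productSpan_cons.1 hx
    have h' : ∀ c ∈ l, a * c = -(c * a) := fun c hc => h c (List.mem_cons_of_mem _ hc)
    have hc : a * c = -(c * a) := h c List.mem_cons_self
    rw [mul_add, ← mul_assoc, ih h' hy, ih h' hz, add_mul, smul_add, smul_mul_assoc, mul_assoc z a,
      hc]
    cases b <;> simp [mul_assoc]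

/-- The members of the list are pairwise anticommuting square roots of `1`. -/
def IsCliffordList {A : Type*} [Ring A] (l : List A) : Prop :=
  l.Pairwise (fun a c => a * c = -(c * a)) ∧ ∀ a ∈ l, a * a = 1

theorem IsCliffordList.tail {A : Type*} [Ring A] {a : A} {l : List A} (h : IsCliffordList (a :: l)) :
    IsCliffordList l :=
  ⟨h.1.tail, fun c hc => h.2 c (List.mem_cons_of_mem _ hc)⟩

theorem mul_mem_productSpan {l : List A} (hl : IsCliffordList l) {a : A} (ha : a ∈ l) {b : Bool}
    {x : A} (hx : x ∈ productSpan l b) : a * x ∈ productSpan l !b := by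
  induction l generalizing b x with
  | nil => simp at ha
  | cons c l ih =>
    obtain ⟨y, hy, z, hz, rfl⟩ := mem_productSpan_cons.1 hx
    rcases List.mem_cons.1 ha with rfl | ha
    · have hanti : ∀ c ∈ l, a * c = -(c * a) := fun c hc => List.rel_of_pairwise_cons hl.1 hc
      have hsq := hl.2 a List.mem_cons_self
      have e : a * (y + z * a) = (if !b then (1 : ℝ) else -1) • z +
          ((if b then (1 : ℝ) else -1) • y) * a := by
        rw [mul_add, ← mul_assoc, mul_comm_of_mem_productSpan hanti hy,
          mul_comm_of_mem_productSpan hanti hz, smul_mul_assoc, mul_assoc z, hsq,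
          mul_one, add_comm, smul_mul_assoc]
      rw [e]
      exact mem_productSpan_cons.2 ⟨_, Submodule.smul_mem _ _ hz, _,
        Submodule.smul_mem _ _ (by simpa using hy), rfl⟩
    · rw [mul_add, ← mul_assoc]
      exact mem_productSpan_cons.2 ⟨_, ih hl.tail ha hy, _, ih hl.tail ha hz, rfl⟩

/-- Write `x = y + z a` with `y` even and `z` odd in the remaining elements. Then `a` commutes with
`y` and anticommutes with `z`, so commuting with `a` forces `z = -z`. Removing the elements in turn
leaves a scalar; no linear independence of the products is needed. -/
theorem mem_one_of_commute {l : List A} (hl : IsCliffordList l) {x : A}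
    (hx : x ∈ productSpan l true) (hcomm : ∀ a ∈ l, a * x = x * a) :
    x ∈ (1 : Submodule ℝ A) := by
  induction l generalizing x with
  | nil => simpa [productSpan] using hx
  | cons a l ih =>
    obtain ⟨y, hy, z, hz, rfl⟩ := mem_productSpan_cons.1 hx
    have hanti : ∀ c ∈ l, a * c = -(c * a) := fun c hc => List.rel_of_pairwise_cons hl.1 hc
    have hsq := hl.2 a List.mem_cons_self
    have h := hcomm a List.mem_cons_self
    rw [mul_add, add_mul, ← mul_assoc, mul_comm_of_mem_productSpan hanti hy,
      mul_comm_of_mem_productSpan hanti hz] at h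
    simp only [Bool.not_true, if_true, one_smul, add_right_inj, Bool.false_eq_true, if_false,
      neg_smul, neg_mul, mul_assoc, hsq, mul_one] at h
    have hz0 : z = 0 := by
      have h2 : (2 : ℝ) • z = 0 := by rw [two_smul]; nth_rw 1 [← h]; simp
      exact (smul_eq_zero.1 h2).resolve_left two_ne_zero
    subst hz0
    rw [zero_mul, add_zero] at hcomm ⊢
    exact ih hl.tail hy fun c hc => hcomm c (List.mem_cons_of_mem _ hc)

end AnticommutingProducts

/-! ### The spin representation of the even Clifford algebra -/

namespace Spin7

open CliffordAlgebra Octonion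

theorem ι_mul_ι_swap (v w : Fin 7 → ℝ) :
    ι euclideanForm7 v * ι euclideanForm7 w =
      algebraMap ℝ _ (2 * inner ℝ (im v) (im w)) - ι euclideanForm7 w * ι euclideanForm7 v := by
  rw [eq_sub_iff_add_eq, ι_mul_ι_add_swap, polar_euclideanForm7]

/-- The standard generators of the Clifford algebra. -/
noncomputable def generators : List (CliffordAlgebra euclideanForm7) :=
  List.ofFn fun i : Fin 7 => ι euclideanForm7 (Pi.single i 1)

theorem isCliffordList_generators : IsCliffordList generators := by
  constructor
  · refine List.pairwise_ofFn.2 fun i j hij => ?_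
    rw [ι_mul_ι_swap, inner_im_im]
    have : ∑ k, (Pi.single i 1 : Fin 7 → ℝ) k * (Pi.single j 1 : Fin 7 → ℝ) k = 0 := by
      simp [Pi.single_apply, hij.ne']
    rw [this]
    simp
  · intro a ha
    obtain ⟨i, rfl⟩ := List.mem_ofFn.1 ha
    rw [ι_sq_scalar, euclideanForm7_apply, inner_im_im]
    simp [Pi.single_apply]

theorem ι_mul_mem_productSpan (v : Fin 7 → ℝ) {b : Bool} {x : CliffordAlgebra euclideanForm7}
    (hx : x ∈ productSpan generators b) :
    ι euclideanForm7 v * x ∈ productSpan generators !b := by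
  have hv : v = ∑ i, v i • (Pi.single i 1 : Fin 7 → ℝ) := by
    ext j; simp [Pi.single_apply]
  rw [hv, map_sum, Finset.sum_mul]
  refine Submodule.sum_mem _ fun i _ => ?_
  rw [map_smul, smul_mul_assoc]
  exact Submodule.smul_mem _ _
    (mul_mem_productSpan isCliffordList_generators (List.mem_ofFn.2 ⟨i, rfl⟩) hx)

/-- Left multiplication by a vector exchanges the two parities, so the even span is stable under
pairs of vectors. -/
theorem even_le_productSpan {x : CliffordAlgebra euclideanForm7} (hx : x ∈ even euclideanForm7) :
    x ∈ productSpan generators true := by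
  have hscalar : ∀ (l : List (CliffordAlgebra euclideanForm7)) (r : ℝ),
      algebraMap ℝ _ r ∈ productSpan l true := fun l r => by
    induction l with
    | nil => simp [productSpan]
    | cons a l ih => exact mem_productSpan_cons.2 ⟨_, ih, 0, Submodule.zero_mem _, by simp⟩
  induction x, hx using even_induction with
  | algebraMap r => exact hscalar _ r
  | add x y hx hy ihx ihy => exact Submodule.add_mem _ ihx ihy
  | ι_mul_ι_mul m₁ m₂ x hx ih =>
    have h := ι_mul_mem_productSpan m₁ (ι_mul_mem_productSpan m₂ ih)
    rwa [Bool.not_not, ← mul_assoc] at h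

/-- The even part of the centre of the Clifford algebra consists of scalars. -/
theorem exists_eq_algebraMap_of_commute {x : CliffordAlgebra euclideanForm7}
    (hx : x ∈ even euclideanForm7) (hcomm : ∀ v, ι euclideanForm7 v * x = x * ι euclideanForm7 v) :
    ∃ r : ℝ, x = algebraMap ℝ _ r := by
  obtain ⟨r, hr⟩ := Submodule.mem_one.1 (mem_one_of_commute isCliffordList_generators
    (even_le_productSpan hx) fun a ha => by
      obtain ⟨i, rfl⟩ := List.mem_ofFn.1 ha
      exact hcomm _)
  exact ⟨r, hr.symm⟩

/-- Right multiplication by the imaginary octonions. -/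
noncomputable def gamma : (Fin 7 → ℝ) →ₗ[ℝ] Module.End ℝ Octonion := rmul ∘ₗ im

theorem gamma_mul_self (v : Fin 7 → ℝ) :
    gamma v * gamma v = -algebraMap ℝ (Module.End ℝ Octonion) (euclideanForm7 v) := by
  rw [euclideanForm7_apply, Algebra.algebraMap_eq_smul_one, ← neg_smul]
  exact rmul_mul_self (re_fst_im v)

theorem gamma_injective : Function.Injective gamma := fun v w h => by
  have h1 := LinearMap.congr_fun h 1
  change 1 * im v = 1 * im w at h1
  rw [Octonion.one_mul, Octonion.one_mul] at h1
  rw [← imCoord_im v, h1, imCoord_im]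

/-- The pairing `(v, w) ↦ -γ(v) γ(w)` defining the spin representation. -/
noncomputable def spinPairing : EvenHom euclideanForm7 (Module.End ℝ Octonion) where
  -- The sign compensates for `γ(v)² = -Q(v)`, whereas vectors in the Clifford algebra square to
  -- `+Q(v)`.
  bilin := -(LinearMap.mul ℝ (Module.End ℝ Octonion)).compl₁₂ gamma gamma
  contract v := by
    simp only [LinearMap.neg_apply, LinearMap.compl₁₂_apply, LinearMap.mul_apply', gamma_mul_self,
      neg_neg]
  contract_mid u v w := by
    simp only [LinearMap.neg_apply, LinearMap.compl₁₂_apply, LinearMap.mul_apply', neg_mul_neg]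
    rw [mul_assoc, ← mul_assoc (gamma v), gamma_mul_self, neg_mul, mul_neg, Algebra.smul_def,
      mul_neg, Algebra.left_comm]

/-- The spin representation of the even Clifford algebra on the octonions. -/
noncomputable def spinRep : even euclideanForm7 →ₐ[ℝ] Module.End ℝ Octonion :=
  even.lift euclideanForm7 spinPairing

theorem spinRep_ι (v w : Fin 7 → ℝ) :
    spinRep ((even.ι euclideanForm7).bilin v w) = -(gamma v * gamma w) :=
  even.lift_ι _ _ _ _

theorem even_subalgebra_induction {P : even euclideanForm7 → Prop}
    (scalar : ∀ r, P (algebraMap ℝ _ r)) (add : ∀ x y, P x → P y → P (x + y))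
    (mul : ∀ v w x, P x → P ((even.ι euclideanForm7).bilin v w * x)) (x : even euclideanForm7) :
    P x := by
  obtain ⟨x, hx⟩ := x
  induction x, hx using even_induction with
  | algebraMap r => exact scalar r
  | add x y hx hy ihx ihy => exact add _ _ ihx ihy
  | ι_mul_ι_mul m₁ m₂ x hx ih => exact mul m₁ m₂ _ ih

/-- The representation of the full Clifford algebra on `𝕆 ⊕ 𝕆`. -/
noncomputable def doubleRep :
    CliffordAlgebra euclideanForm7 →ₐ[ℝ] Matrix (Fin 2) (Fin 2) (Module.End ℝ Octonion) :=
  lift euclideanForm7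
    -- Opposite signs off the diagonal make the square `-γ(v)² = Q(v)` in both blocks.
    ⟨{  toFun := fun v => !![0, gamma v; -gamma v, 0]
        map_add' := fun v w => by ext1 i j; fin_cases i <;> fin_cases j <;> simp [add_comm]
        map_smul' := fun r v => by ext1 i j; fin_cases i <;> fin_cases j <;> simp },
      fun v => by
        change !![0, gamma v; -gamma v, 0] * !![0, gamma v; -gamma v, 0] = _
        ext1 i j
        fin_cases i <;> fin_cases j <;>
          simp [Matrix.mul_apply, gamma_mul_self, Matrix.algebraMap_matrix_apply]⟩

theorem doubleRep_ι (v : Fin 7 → ℝ) :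
    doubleRep (ι euclideanForm7 v) = !![0, gamma v; -gamma v, 0] :=
  lift_ι_apply _ _ _

theorem coe_bilin (v w : Fin 7 → ℝ) : ((even.ι euclideanForm7).bilin v w :
    CliffordAlgebra euclideanForm7) = ι euclideanForm7 v * ι euclideanForm7 w := rfl

theorem doubleRep_even (x : even euclideanForm7) :
    doubleRep x = !![spinRep x, 0; 0, spinRep x] := by
  induction x using even_subalgebra_induction with
  | scalar r =>
    rw [AlgHom.commutes, Subalgebra.coe_algebraMap, AlgHom.commutes]
    ext1 i j
    fin_cases i <;> fin_cases j <;> simp [Matrix.algebraMap_matrix_apply]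
  | add x y ihx ihy =>
    rw [Subalgebra.coe_add, map_add, map_add, ihx, ihy]
    ext1 i j
    fin_cases i <;> fin_cases j <;> simp
  | mul v w x ih =>
    rw [Subalgebra.coe_mul, map_mul, map_mul, ih, coe_bilin, map_mul, doubleRep_ι, doubleRep_ι,
      spinRep_ι]
    ext1 i j
    fin_cases i <;> fin_cases j <;> simp [Matrix.mul_apply]

/-- The hypothesis is a relation between odd elements, on which `spinRep` is undefined. It is
transported through `doubleRep`, where even elements are block scalar, and read off in the upper
right block. -/
theorem spinRep_mul_gamma {x : even euclideanForm7} {v w : Fin 7 → ℝ}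
    (h : (x : CliffordAlgebra euclideanForm7) * ι euclideanForm7 v = ι euclideanForm7 w * x) :
    spinRep x * gamma v = gamma w * spinRep x := by
  have h' := congrArg (fun y => doubleRep y 0 1) h
  simp only [map_mul, doubleRep_even, doubleRep_ι] at h'
  simpa [Matrix.mul_apply] using h'

theorem star_mem_even {x : CliffordAlgebra euclideanForm7} (hx : x ∈ even euclideanForm7) :
    star x ∈ even euclideanForm7 := by
  change star x ∈ evenOdd euclideanForm7 0
  rw [star_def, reverse_mem_evenOdd_iff, involute_mem_evenOdd_iff]
  exact hx

theorem inner_gamma_left (v : Fin 7 → ℝ) (y z : Octonion) :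
    inner ℝ (gamma v y) z = -inner ℝ y (gamma v z) :=
  inner_rmul_left (re_fst_im v) y z

/-- Each `γ(v)` is skew-adjoint, so the adjoint of `γ(v)γ(w)` is `γ(w)γ(v)`, just as `star` reverses
a product of two vectors with cancelling signs. Hence `star s * s = 1` makes `s` act isometrically.
-/
theorem inner_spinRep_left (x : even euclideanForm7) (y z : Octonion) :
    inner ℝ (spinRep x y) z = inner ℝ y (spinRep ⟨star x.1, star_mem_even x.2⟩ z) := by
  induction x using even_subalgebra_induction generalizing y z with
  | scalar r =>
    have h : (⟨star (algebraMap ℝ (even euclideanForm7) r).1, star_mem_even (Subtype.prop _)⟩ :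
      even euclideanForm7) = algebraMap ℝ _ r := Subtype.ext (star_algebraMap r)
    rw [h, AlgHom.commutes]
    simp [Algebra.algebraMap_eq_smul_one, inner_smul_left, inner_smul_right]
  | add a b iha ihb =>
    have h : (⟨star (a + b).1, star_mem_even (Subtype.prop _)⟩ : even euclideanForm7) =
      ⟨star a.1, star_mem_even a.2⟩ + ⟨star b.1, star_mem_even b.2⟩ :=
      Subtype.ext (star_add a.1 b.1)
    rw [h, map_add, map_add, LinearMap.add_apply, LinearMap.add_apply, inner_add_left,
      inner_add_right, iha, ihb]
  | mul v w a ih =>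
    have h : (⟨star ((even.ι euclideanForm7).bilin v w * a).1, star_mem_even (Subtype.prop _)⟩ :
        even euclideanForm7) =
        ⟨star a.1, star_mem_even a.2⟩ * (even.ι euclideanForm7).bilin w v := Subtype.ext (by
      change star (ι euclideanForm7 v * ι euclideanForm7 w * a.1) =
        star a.1 * (ι euclideanForm7 w * ι euclideanForm7 v)
      simp [star_mul, star_ι])
    rw [h, map_mul, map_mul, spinRep_ι, spinRep_ι]
    simp only [Module.End.mul_apply, LinearMap.neg_apply, inner_neg_left, inner_gamma_left, neg_neg,
      ih, map_neg, inner_neg_right]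

end Spin7

/-! ### Reflections and their determinants -/

theorem real_reflection_singleton_apply {E : Type*} [NormedAddCommGroup E]
    [InnerProductSpace ℝ E] (a x : E) :
    (ℝ ∙ a).reflection x = (2 * (inner ℝ a x / ‖a‖ ^ 2)) • a - x := by
  rw [Submodule.reflection_singleton_apply, mul_smul, two_smul, two_smul]
  simp

theorem reflection_orthogonal_singleton_apply {E : Type*} [NormedAddCommGroup E]
    [InnerProductSpace ℝ E] (a x : E) :
    (ℝ ∙ a)ᗮ.reflection x = x - (2 * (inner ℝ a x / ‖a‖ ^ 2)) • a := by
  rw [Submodule.reflection_orthogonal_apply, real_reflection_singleton_apply, neg_sub]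

theorem mem_specialOrthogonal {A : Type*} [NormedAddCommGroup A] [InnerProductSpace ℝ A]
    {θ : A ≃ₗᵢ[ℝ] A} : θ ∈ specialOrthogonal A ↔
      LinearMap.det (θ.toLinearEquiv : A →ₗ[ℝ] A) = 1 := Iff.rfl

theorem det_mul_isometry {A : Type*} [NormedAddCommGroup A] [InnerProductSpace ℝ A]
    (θ η : A ≃ₗᵢ[ℝ] A) : LinearMap.det ((θ * η).toLinearEquiv : A →ₗ[ℝ] A) =
      LinearMap.det (θ.toLinearEquiv : A →ₗ[ℝ] A) *
        LinearMap.det (η.toLinearEquiv : A →ₗ[ℝ] A) :=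
  LinearMap.det_comp _ _

namespace Octonion

instance : Fact (Module.finrank ℝ Octonion = 7 + 1) := ⟨finrank_eq_eight⟩

theorem det_reflection_singleton {a : Octonion} (ha : a ≠ 0) :
    LinearMap.det ((ℝ ∙ a).reflection.toLinearEquiv : Octonion →ₗ[ℝ] Octonion) = -1 := by
  refine (Submodule.det_reflection (K := ℝ ∙ a)).trans ?_
  rw [Submodule.finrank_orthogonal_span_singleton (n := 7) ha]
  norm_num

theorem det_reflection_orthogonal_singleton {a : Octonion} (ha : a ≠ 0) :
    LinearMap.det ((ℝ ∙ a)ᗮ.reflection.toLinearEquiv : Octonion →ₗ[ℝ] Octonion) = -1 := by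
  refine (Submodule.det_reflection (K := (ℝ ∙ a)ᗮ)).trans ?_
  rw [Submodule.orthogonal_orthogonal, finrank_span_singleton ha, pow_one]

theorem im_ne_zero {v : Fin 7 → ℝ} (hv : v ≠ 0) : im v ≠ 0 := fun h => hv (by
  rw [← imCoord_im v, h, map_zero])

theorem inner_one_im (v : Fin 7 → ℝ) : inner ℝ (1 : Octonion) (im v) = 0 := by
  rw [inner_one_left, re_fst_im]

theorem norm_im_sq (v : Fin 7 → ℝ) : ‖im v‖ ^ 2 = euclideanForm7 v := by
  rw [euclideanForm7_apply, real_inner_self_eq_norm_sq]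

end Octonion

/-! ### Clifford elements and isometries of `ℝ⁷` -/

namespace Spin7

open CliffordAlgebra Octonion

/-- Conjugation by an element of the Lipschitz group acts on `ℝ⁷` by rotations. -/
theorem exists_rotation_of_mem_lipschitzGroup {g : (CliffordAlgebra euclideanForm7)ˣ}
    (hg : g ∈ lipschitzGroup euclideanForm7) :
    ∃ θ ∈ specialOrthogonal Octonion, θ 1 = 1 ∧ ∀ v, (g : CliffordAlgebra euclideanForm7) *
      ι euclideanForm7 v = ι euclideanForm7 (imCoord (θ (im v))) * g := by
  induction hg using Subgroup.closure_induction with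
  | mem g hg =>
    obtain ⟨a, ha⟩ := hg
    have hQ : euclideanForm7 a ≠ 0 := by
      have : IsUnit (ι euclideanForm7 a) := ha ▸ g.isUnit
      exact (isUnit_of_isUnit_ι _ this).ne_zero
    have ha0 : a ≠ 0 := fun h => hQ (by rw [h, map_zero])
    -- Untwisted conjugation by `a` fixes `a` and negates its complement in `ℝ⁷`. The reflection in
    -- the line of `im a` does this but also sends `1` to `-1`; the second reflection repairs that
    -- and makes the determinant `1`.
    refine ⟨(ℝ ∙ im a).reflection * (ℝ ∙ (1 : Octonion))ᗮ.reflection, ?_, ?_, fun v => ?_⟩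
    · rw [mem_specialOrthogonal, det_mul_isometry, det_reflection_singleton (im_ne_zero ha0),
        det_reflection_orthogonal_singleton Octonion.one_ne_zero]
      norm_num
    · change (ℝ ∙ im a).reflection ((ℝ ∙ (1 : Octonion))ᗮ.reflection 1) = 1
      rw [reflection_orthogonal_singleton_apply, real_reflection_singleton_apply,
        inner_sub_right, inner_smul_right, real_inner_comm, inner_one_im, Octonion.norm_one,
        real_inner_self_eq_norm_sq, Octonion.norm_one]
      simp [two_smul]
    · change _ = ι euclideanForm7 (imCoord ((ℝ ∙ im a).reflection
        ((ℝ ∙ (1 : Octonion))ᗮ.reflection (im v)))) * _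
      rw [reflection_orthogonal_singleton_apply, real_reflection_singleton_apply, inner_one_im,
        ← ha, ι_mul_ι_swap]
      simp only [zero_div, mul_zero, zero_smul, sub_zero, map_sub, map_smul, imCoord_im, sub_mul,
        smul_mul_assoc, ι_sq_scalar, norm_im_sq]
      rw [Algebra.smul_def, ← map_mul (algebraMap ℝ _), mul_assoc, div_mul_cancel₀ _ hQ]
  | one => exact ⟨1, one_mem _, rfl, fun v => by simp⟩
  | mul g h _ _ ihg ihh =>
    obtain ⟨θ, hθ, hθ1, hg⟩ := ihg
    obtain ⟨η, hη, hη1, hh⟩ := ihh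
    refine ⟨θ * η, mul_mem hθ hη, ?_, fun v => ?_⟩
    · change θ (η 1) = 1
      rw [hη1, hθ1]
    · change _ = ι euclideanForm7 (imCoord (θ (η (im v)))) * _
      rw [Units.val_mul, mul_assoc, hh, ← mul_assoc, hg, im_imCoord (re_fst_map_im hη1 v), mul_assoc]
  | inv g _ ih =>
    obtain ⟨θ, hθ, hθ1, hg⟩ := ih
    have hθ1' : θ⁻¹ 1 = 1 := by
      change θ.symm 1 = 1
      rw [LinearIsometryEquiv.symm_apply_eq, hθ1]
    refine ⟨θ⁻¹, inv_mem hθ, hθ1', fun v => ?_⟩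
    rw [Units.inv_mul_eq_iff_eq_mul, ← mul_assoc, hg, im_imCoord (re_fst_map_im hθ1' v),
      mul_assoc, Units.mul_inv, mul_one]
    change _ = ι euclideanForm7 (imCoord (θ (θ.symm (im v))))
    rw [θ.apply_symm_apply, imCoord_im]

/-- Data lifting an isometry of `ℝ⁷` to the Lipschitz group, with the sign `c` of its
determinant. -/
theorem exists_lift_of_isometry
    (η : EuclideanSpace ℝ (Fin 7) ≃ₗᵢ[ℝ] EuclideanSpace ℝ (Fin 7)) :
    ∃ (i : ZMod 2) (c : ℝ) (g : (CliffordAlgebra euclideanForm7)ˣ)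
      (θ : Octonion ≃ₗᵢ[ℝ] Octonion), (c = 1 → i = 0) ∧
      g ∈ lipschitzGroup euclideanForm7 ∧ (g : CliffordAlgebra euclideanForm7) ∈
        evenOdd euclideanForm7 i ∧
      star (g : CliffordAlgebra euclideanForm7) * g = algebraMap ℝ _ c ∧
      (∀ v, (g : CliffordAlgebra euclideanForm7) * ι euclideanForm7 (WithLp.ofLp v) =
        c • (ι euclideanForm7 (WithLp.ofLp (η v)) * g)) ∧
      LinearMap.det (θ.toLinearEquiv : Octonion →ₗ[ℝ] Octonion) = c ∧ θ 1 = 1 ∧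
      ∀ v, θ (im (WithLp.ofLp v)) = im (WithLp.ofLp (η v)) := by
  obtain ⟨l, -, rfl⟩ := η.reflections_generate_dim
  -- The induction needs parity and sign tied together in both cases: each genuine reflection flips
  -- both.
  suffices h : ∃ (i : ZMod 2) (c : ℝ) (g : (CliffordAlgebra euclideanForm7)ˣ)
      (θ : Octonion ≃ₗᵢ[ℝ] Octonion), (i = 0 ∧ c = 1 ∨ i = 1 ∧ c = -1) ∧
      g ∈ lipschitzGroup euclideanForm7 ∧ (g : CliffordAlgebra euclideanForm7) ∈
        evenOdd euclideanForm7 i ∧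
      star (g : CliffordAlgebra euclideanForm7) * g = algebraMap ℝ _ c ∧
      (∀ v, (g : CliffordAlgebra euclideanForm7) * ι euclideanForm7 (WithLp.ofLp v) =
        c • (ι euclideanForm7 (WithLp.ofLp
          ((l.map fun v => (ℝ ∙ v)ᗮ.reflection).prod v)) * g)) ∧
      LinearMap.det (θ.toLinearEquiv : Octonion →ₗ[ℝ] Octonion) = c ∧ θ 1 = 1 ∧
      ∀ v, θ (im (WithLp.ofLp v)) =
        im (WithLp.ofLp ((l.map fun v => (ℝ ∙ v)ᗮ.reflection).prod v)) by
    obtain ⟨i, c, g, θ, hic, h⟩ := h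
    refine ⟨i, c, g, θ, fun hc => ?_, h⟩
    rcases hic with h | h
    · exact h.1
    · rw [h.2] at hc; norm_num at hc
  induction l with
  | nil =>
    exact ⟨0, 1, 1, 1, Or.inl ⟨rfl, rfl⟩, one_mem _, SetLike.one_mem_graded _, by simp,
      fun v => by simp, LinearMap.det_id, rfl, fun v => rfl⟩
  | cons a l ih =>
    obtain ⟨i, c, g, θ, hic, hg, hgi, hstar, hgv, hdet, hθ1, hθ⟩ := ih
    set η := (l.map fun v => (ℝ ∙ v)ᗮ.reflection).prod with hη
    simp only [List.map_cons, List.prod_cons, ← hη, LinearIsometryEquiv.coe_mul,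
      Function.comp_apply]
    -- A zero vector in the list contributes the identity, so the lift is unchanged.
    by_cases ha : a = 0
    · refine ⟨i, c, g, θ, hic, hg, hgi, hstar, fun v => ?_, hdet, hθ1, fun v => ?_⟩
      · rw [hgv, reflection_orthogonal_singleton_apply, ha, smul_zero, sub_zero]
      · rw [hθ, reflection_orthogonal_singleton_apply, ha, smul_zero, sub_zero]
    have ha' : WithLp.ofLp a ≠ 0 := fun h => ha (WithLp.ofLp_injective 2 h)
    have hinner : ∀ v w : EuclideanSpace ℝ (Fin 7), inner ℝ v w =
        inner ℝ (im (WithLp.ofLp v)) (im (WithLp.ofLp w)) := fun v w => by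
      rw [inner_im_im, PiLp.inner_apply]
      simp [mul_comm]
    have hnorm : ‖im (WithLp.ofLp a)‖ ^ 2 = ‖a‖ ^ 2 := by
      rw [← real_inner_self_eq_norm_sq, ← real_inner_self_eq_norm_sq, hinner]
    have hna : ‖a‖ ≠ 0 := norm_ne_zero_iff.2 ha
    -- For a unit vector, `u² = 1` and `star u = -u`, so multiplying by `u` changes the sign of
    -- `star g * g`.
    obtain ⟨u, hu⟩ : ∃ u : Fin 7 → ℝ, u = ‖a‖⁻¹ • WithLp.ofLp a := ⟨_, rfl⟩
    have hQu : euclideanForm7 u = 1 := by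
      rw [hu, QuadraticMap.map_smul, ← norm_im_sq, hnorm, smul_eq_mul]
      field_simp
    have huu : ι euclideanForm7 u * ι euclideanForm7 u = 1 := by
      rw [ι_sq_scalar, hQu, map_one]
    let U : (CliffordAlgebra euclideanForm7)ˣ :=
      ⟨ι euclideanForm7 u, ι euclideanForm7 u, huu, huu⟩
    have hrefl : ∀ w : EuclideanSpace ℝ (Fin 7),
        im (WithLp.ofLp ((ℝ ∙ a)ᗮ.reflection w)) =
          (ℝ ∙ im (WithLp.ofLp a))ᗮ.reflection (im (WithLp.ofLp w)) := fun w => by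
      rw [reflection_orthogonal_singleton_apply, reflection_orthogonal_singleton_apply, hnorm,
        hinner, WithLp.ofLp_sub, WithLp.ofLp_smul, map_sub, map_smul]
    have hUw : ∀ w : EuclideanSpace ℝ (Fin 7),
        ι euclideanForm7 u * ι euclideanForm7 (WithLp.ofLp w) =
          -(ι euclideanForm7 (WithLp.ofLp ((ℝ ∙ a)ᗮ.reflection w)) * ι euclideanForm7 u) :=
        fun w => by
      have e : WithLp.ofLp ((ℝ ∙ a)ᗮ.reflection w) =
          WithLp.ofLp w - (2 * inner ℝ (im u) (im (WithLp.ofLp w))) • u := by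
        rw [reflection_orthogonal_singleton_apply, hu, map_smul, inner_smul_left, hinner,
          WithLp.ofLp_sub, WithLp.ofLp_smul, smul_smul]
        congr 2
        simp only [RCLike.conj_to_real]
        field_simp
      rw [e, map_sub, map_smul, sub_mul, smul_mul_assoc, huu, ι_mul_ι_swap,
        Algebra.algebraMap_eq_smul_one, neg_sub]
    refine ⟨1 + i, -c, U * g, (ℝ ∙ im (WithLp.ofLp a))ᗮ.reflection * θ, ?_, ?_, ?_, ?_, fun v => ?_,
      ?_, ?_, fun v => ?_⟩
    · rcases hic with ⟨rfl, rfl⟩ | ⟨rfl, rfl⟩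
      · exact Or.inr ⟨rfl, rfl⟩
      · exact Or.inl ⟨rfl, neg_neg 1⟩
    · exact mul_mem (Subgroup.subset_closure ⟨u, rfl⟩) hg
    · exact SetLike.mul_mem_graded (ι_mem_evenOdd_one _ _) hgi
    · rw [Units.val_mul, star_mul]
      change star (g : CliffordAlgebra euclideanForm7) * star (ι euclideanForm7 u) *
        (ι euclideanForm7 u * g) = _
      rw [star_ι, mul_neg, neg_mul, mul_assoc, ← mul_assoc (ι euclideanForm7 u), huu, one_mul,
        hstar, map_neg]
    · rw [Units.val_mul, mul_assoc, hgv, mul_smul_comm, ← mul_assoc]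
      change c • (ι euclideanForm7 u * _ * _) = -c • (_ * (ι euclideanForm7 u * _))
      rw [hUw, neg_mul, smul_neg, neg_smul, mul_assoc]
    · rw [det_mul_isometry, hdet, det_reflection_orthogonal_singleton (im_ne_zero ha'), neg_one_mul]
    · change (ℝ ∙ im (WithLp.ofLp a))ᗮ.reflection (θ 1) = 1
      rw [hθ1, reflection_orthogonal_singleton_apply, real_inner_comm, inner_one_im]
      simp
    · change (ℝ ∙ im (WithLp.ofLp a))ᗮ.reflection (θ _) = _
      rw [hθ, hrefl]

end Spin7

/-! ### `Spin(7)` as the twisted isometries of the octonionic line -/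

namespace Spin7

open CliffordAlgebra Octonion

/-- `Spin(7)` acts on the octonions by isometries. -/
noncomputable def spinIsometry : Spin7 →* (Octonion ≃ₗᵢ[ℝ] Octonion) where
  toFun s :=
    { toFun := spinRep (toEven s)
      invFun := spinRep (toEven (star s))
      map_add' := map_add _
      map_smul' := map_smul _
      left_inv := fun y => by
        rw [← Module.End.mul_apply, ← map_mul,
          show toEven (star s) * toEven s = 1 from Subtype.ext (spinGroup.coe_star_mul_self s),
          map_one, Module.End.one_apply]
      right_inv := fun y => by
        rw [← Module.End.mul_apply, ← map_mul,
          show toEven s * toEven (star s) = 1 from Subtype.ext (spinGroup.coe_mul_star_self s),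
          map_one, Module.End.one_apply]
      norm_map' := fun y => by
        change ‖spinRep (toEven s) y‖ = ‖y‖
        rw [← sq_eq_sq₀ (norm_nonneg _) (norm_nonneg _), ← real_inner_self_eq_norm_sq,
          ← real_inner_self_eq_norm_sq, inner_spinRep_left, ← Module.End.mul_apply, ← map_mul,
          show (⟨star (toEven s).1, _⟩ : even euclideanForm7) * toEven s = 1 from
            Subtype.ext (spinGroup.coe_star_mul_self s), map_one, Module.End.one_apply] }
  map_one' := by
    ext1 y
    change spinRep 1 y = y
    rw [map_one, Module.End.one_apply]
  map_mul' s t := by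
    ext1 y
    change spinRep (toEven s * toEven t) y = spinRep (toEven s) (spinRep (toEven t) y)
    rw [map_mul, Module.End.mul_apply]

theorem exists_rotation (s : Spin7) :
    ∃ θ ∈ specialOrthogonal Octonion, θ 1 = 1 ∧ ∀ v, s.1 * ι euclideanForm7 v =
      ι euclideanForm7 (imCoord (θ (im v))) * s.1 := by
  obtain ⟨g, hg, hgs⟩ := pinGroup.mem_lipschitzGroup (spinGroup.mem_pin s.2)
  obtain ⟨θ, hθ, h1, h⟩ := exists_rotation_of_mem_lipschitzGroup hg
  refine ⟨θ, hθ, h1, ?_⟩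
  rw [← hgs]
  exact h

/-- If `Ψ(s) = 1`, the intertwining relation gives `γ(v) = γ(θ v)`, so `θ` is trivial on imaginary
octonions and `s` commutes with every vector. Being even, `s` is a scalar, and `Ψ(s) = 1` makes it
`1`. -/
theorem spinIsometry_injective : Function.Injective spinIsometry := by
  rw [injective_iff_map_eq_one]
  intro s hs
  have hΨ : spinRep (toEven s) = 1 := LinearMap.ext fun y => DFunLike.congr_fun hs y
  obtain ⟨θ, -, -, h⟩ := exists_rotation s
  have hcomm : ∀ v, ι euclideanForm7 v * s.1 = s.1 * ι euclideanForm7 v := fun v => by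
    have hv := spinRep_mul_gamma (x := toEven s) (h v)
    rw [hΨ, one_mul, mul_one] at hv
    rw [h v, ← gamma_injective hv]
  obtain ⟨r, hr⟩ := exists_eq_algebraMap_of_commute (spinGroup.mem_even s.2) hcomm
  have hr' : toEven s = algebraMap ℝ _ r := Subtype.ext hr
  rw [hr', AlgHom.commutes] at hΨ
  have h1 := LinearMap.congr_fun hΨ 1
  rw [Module.algebraMap_end_apply, Module.End.one_apply] at h1
  have hr1 : r = 1 := by
    have := congrArg (fun x : Octonion => x.fst.re) h1
    simpa using this
  refine Subtype.ext ?_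
  rw [hr, hr1, map_one]
  rfl

/-- If `θ 1 = 1`, then `f (y * x) = f y * θ x` for all `x` as soon as it holds for imaginary `x`. -/
theorem map_mul_iff_gamma {f : Module.End ℝ Octonion} {θ : Octonion ≃ₗᵢ[ℝ] Octonion}
    (h1 : θ 1 = 1) : (∀ y x, f (y * x) = f y * θ x) ↔
      ∀ v, f * gamma v = gamma (imCoord (θ (im v))) * f := by
  have hγ : ∀ v y, gamma (imCoord (θ (im v))) y = y * θ (im v) := fun v y => by
    change y * im (imCoord (θ (im v))) = _
    rw [im_imCoord (re_fst_map_im h1 v)]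
  constructor
  · intro h v
    ext1 y
    change f (y * im v) = gamma (imCoord (θ (im v))) (f y)
    rw [hγ, h]
  · intro h y x
    have hv : f (y * im (imCoord x)) = f y * θ (im (imCoord x)) := by
      rw [← hγ]
      exact LinearMap.congr_fun (h (imCoord x)) y
    have e : ∀ z r w, z * (r • (1 : Octonion) + w) = r • z + z * w := fun z r w => by
      rw [← rmul_apply, map_add, map_smul, rmul_one]
      rfl
    conv_lhs => rw [eq_re_add_im x]
    conv_rhs => rw [eq_re_add_im x]
    rw [e, map_add, map_smul, hv, map_add, map_smul, h1, e]

theorem spinIsometry_mul (s : Spin7) : ∃ θ ∈ specialOrthogonal Octonion,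
    ∀ y x, spinIsometry s (y * x) = spinIsometry s y * θ x := by
  obtain ⟨θ, hθ, h1, h⟩ := exists_rotation s
  exact ⟨θ, hθ, (map_mul_iff_gamma (f := spinRep (toEven s)) h1).2 fun v =>
    spinRep_mul_gamma (x := toEven s) (h v)⟩

/-- It is the product of the unit vectors `-e₀` and `e₀`. It supplies the sign left undetermined
when a rotation is lifted. -/
theorem neg_one_mem : (-1 : CliffordAlgebra euclideanForm7) ∈ Spin7 := by
  have hsq : ι euclideanForm7 (Pi.single 0 1) * ι euclideanForm7 (Pi.single 0 1) = 1 :=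
    isCliffordList_generators.2 _ (List.mem_ofFn.2 ⟨0, rfl⟩)
  let U : (CliffordAlgebra euclideanForm7)ˣ :=
    ⟨ι euclideanForm7 (Pi.single 0 1), ι euclideanForm7 (Pi.single 0 1), hsq, hsq⟩
  refine ⟨⟨⟨-U * U, ?_, ?_⟩, ?_⟩, ?_⟩
  · exact mul_mem (Subgroup.subset_closure ⟨-Pi.single 0 1, by simp [U]⟩)
      (Subgroup.subset_closure ⟨Pi.single 0 1, rfl⟩)
  · simp [U, hsq]
  · exact Unitary.mem_iff.2 (by simp)
  · exact (even euclideanForm7).neg_mem (one_mem _)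

/-- Every isometry intertwining right multiplications up to a rotation comes from `Spin(7)`. -/
theorem exists_spinIsometry_eq {φ θ : Octonion ≃ₗᵢ[ℝ] Octonion}
    (hθ : θ ∈ specialOrthogonal Octonion) (h : ∀ y x, φ (y * x) = φ y * θ x) :
    ∃ s, spinIsometry s = φ := by
  have hφ1 : φ 1 ≠ 0 := by simpa using Octonion.one_ne_zero
  have h1 : θ 1 = 1 := Octonion.mul_left_cancel hφ1 (by rw [← h, Octonion.mul_one, Octonion.mul_one])
  let η₀ : EuclideanSpace ℝ (Fin 7) →ₗᵢ[ℝ] EuclideanSpace ℝ (Fin 7) :=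
    { toFun := fun v => WithLp.toLp 2 (imCoord (θ (im (WithLp.ofLp v))))
      map_add' := fun v w => by simp
      map_smul' := fun r v => by simp
      norm_map' := fun v => by
        have hn : ∀ w : Fin 7 → ℝ,
            ‖(WithLp.toLp 2 w : EuclideanSpace ℝ (Fin 7))‖ = ‖im w‖ := fun w => by
          rw [← sq_eq_sq₀ (norm_nonneg _) (norm_nonneg _), ← real_inner_self_eq_norm_sq,
            ← real_inner_self_eq_norm_sq, inner_im_im, PiLp.inner_apply]
          simp [sq]
        change ‖(WithLp.toLp 2 (imCoord (θ (im (WithLp.ofLp v)))) :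
          EuclideanSpace ℝ (Fin 7))‖ = ‖(WithLp.toLp 2 (WithLp.ofLp v) :
          EuclideanSpace ℝ (Fin 7))‖
        rw [hn, hn, im_imCoord (re_fst_map_im h1 _), θ.norm_map] }
  let η := η₀.toLinearIsometryEquiv rfl
  have hη : ∀ v, WithLp.ofLp (η v) = imCoord (θ (im (WithLp.ofLp v))) := fun v => rfl
  obtain ⟨i, c, g, θ', hci, hg, hgi, hstar, hgv, hdet, hθ'1, hθ'⟩ := exists_lift_of_isometry η
  have hθθ' : θ' = θ := ext_of_im (hθ'1.trans h1.symm) fun v => by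
    rw [hθ' (WithLp.toLp 2 v), hη, im_imCoord (re_fst_map_im h1 _)]
  -- Here `det θ = 1` is used: it makes the lift even and unitary.
  have hc : c = 1 := by
    rw [← hdet, hθθ']
    exact hθ
  have hi : i = 0 := hci hc
  subst hc hi
  rw [map_one] at hstar
  have hs : (g : CliffordAlgebra euclideanForm7) ∈ Spin7 := by
    refine ⟨⟨⟨g, hg, rfl⟩, Unitary.mem_iff.2 ⟨hstar, ?_⟩⟩, hgi⟩
    rw [← Units.inv_eq_of_mul_eq_one_left hstar, Units.mul_inv]
  let s : Spin7 := ⟨g, hs⟩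
  have hsv : ∀ v, s.1 * ι euclideanForm7 v = ι euclideanForm7 (imCoord (θ (im v))) * s.1 :=
    fun v => by
      have := hgv (WithLp.toLp 2 v)
      rwa [hη, one_smul] at this
  have hsθ : ∀ y x, spinIsometry s (y * x) = spinIsometry s y * θ x :=
    (map_mul_iff_gamma (f := spinRep (toEven s)) h1).2 fun v =>
      spinRep_mul_gamma (x := toEven s) (hsv v)
  -- Both factors have the twist `θ`, so `ψ` is right `𝕆`-linear. Thus `ψ` is left multiplication by
  -- `ψ 1`, and linearity puts `ψ 1` in the left nucleus.
  let ψ := (spinIsometry s)⁻¹ * φ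
  have hsψ : ∀ y, spinIsometry s (ψ y) = φ y := fun y => (spinIsometry s).apply_symm_apply (φ y)
  have hψ : ∀ y x, ψ (y * x) = ψ y * x := fun y x => by
    apply (spinIsometry s).injective
    rw [hsθ, hsψ, hsψ, h]
  have hψ1 : ∀ x, ψ x = ψ 1 * x := fun x => by rw [← hψ, Octonion.one_mul]
  have hreal := eq_smul_one_of_left_nucleus (a := ψ 1) fun x y => by
    rw [← hψ1, hψ, hψ1 x]
  obtain ⟨r, hr⟩ : ∃ r : ℝ, ψ 1 = r • (1 : Octonion) := ⟨_, hreal⟩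
  have hψr : ∀ x, ψ x = r • x := fun x => by
    rw [hψ1, hr]
    ext1 <;> simp
  have habs : |r| = 1 := by
    have := ψ.norm_map 1
    rwa [hr, norm_smul, Octonion.norm_one, mul_one, Real.norm_eq_abs] at this
  have hφ : ∀ x, φ x = r • spinIsometry s x := fun x => by rw [← hsψ, hψr, map_smul]
  rcases eq_or_eq_neg_of_abs_eq habs with rfl | rfl
  · exact ⟨s, by ext1 x; rw [hφ, one_smul]⟩
  · refine ⟨⟨-1, neg_one_mem⟩ * s, ?_⟩
    ext1 x
    rw [hφ, map_mul]
    change spinRep (-1) (spinIsometry s x) = _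
    rw [map_neg, map_one]
    simp

/-- The octonionic line, identified with the octonions. -/
noncomputable def lineEquiv : LinearSpaceOver Octonion 1 ≃ₗᵢ[ℝ] Octonion where
  toFun v := v 0
  invFun x := WithLp.toLp 2 fun _ => x
  map_add' _ _ := rfl
  map_smul' _ _ := rfl
  left_inv v := by ext1 i; rw [Subsingleton.elim i 0]
  right_inv _ := rfl
  norm_map' v := by
    change ‖v 0‖ = ‖v‖
    simp [PiLp.norm_eq_of_L2]

theorem lineEquiv_rightMul (v : LinearSpaceOver Octonion 1) (x : Octonion) :
    lineEquiv (rightMul v x) = lineEquiv v * x := rfl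

/-- The action of `Spin(7)` on the octonionic line. -/
noncomputable def lineAction :
    Spin7 →* (LinearSpaceOver Octonion 1 ≃ₗᵢ[ℝ] LinearSpaceOver Octonion 1) where
  toFun s := (lineEquiv.trans (spinIsometry s)).trans lineEquiv.symm
  map_one' := by ext1 v; simp
  map_mul' s t := by ext1 v; simp

theorem lineAction_apply (s : Spin7) (v : LinearSpaceOver Octonion 1) :
    lineAction s v = lineEquiv.symm (spinIsometry s (lineEquiv v)) := rfl

theorem lineAction_injective : Function.Injective lineAction := fun s t h => by
  refine spinIsometry_injective (LinearIsometryEquiv.ext fun y => ?_)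
  have := DFunLike.congr_fun h (lineEquiv.symm y)
  simpa [lineAction_apply] using this

theorem range_lineAction : lineAction.range = twistedIso Octonion 1 := by
  ext φ
  constructor
  · rintro ⟨s, rfl⟩
    obtain ⟨θ, hθ, h⟩ := spinIsometry_mul s
    refine ⟨θ, hθ, fun v x => lineEquiv.injective ?_⟩
    rw [lineEquiv_rightMul, lineAction_apply, lineAction_apply, lineEquiv.apply_symm_apply,
      lineEquiv.apply_symm_apply, lineEquiv_rightMul, h]
  · rintro ⟨θ, hθ, h⟩
    obtain ⟨s, hs⟩ := exists_spinIsometry_eq (φ := (lineEquiv.symm.trans φ).trans lineEquiv) hθ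
      fun y x => by
        change lineEquiv (φ (rightMul (lineEquiv.symm y) x)) = _
        rw [h, lineEquiv_rightMul]
        rfl
    refine ⟨s, LinearIsometryEquiv.ext fun v => ?_⟩
    rw [lineAction_apply, hs]
    simp

end Spin7

theorem mainTheorem2 :
    -- `G_ℝ(n) = O(n)`, acting on `ℝⁿ` by matrices
    (∀ n : ℕ, ∃ e : twistedIso ℝ n ≃* Matrix.orthogonalGroup (Fin n) ℝ,
      ∀ (φ : twistedIso ℝ n) (v : LinearSpaceOver ℝ n),
        φ.1 v = WithLp.toLp 2 ((e φ).1 *ᵥ WithLp.ofLp v)) ∧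
    -- `G_ℂ(n) = U(n)`, acting on `ℂⁿ` by matrices
    (∀ n : ℕ, ∃ e : twistedIso ℂ n ≃* Matrix.unitaryGroup (Fin n) ℂ,
      ∀ (φ : twistedIso ℂ n) (v : LinearSpaceOver ℂ n),
        φ.1 v = WithLp.toLp 2 ((e φ).1 *ᵥ WithLp.ofLp v)) ∧
    -- `G_ℍ(n) = Sp(n)Sp(1)`: the image of `Sp(n) × Sp(1)` acting on `ℍⁿ` by `v ↦ B v q⁻¹`,
    -- that is, `Sp(n) × Sp(1)` modulo `{(1, 1), (-1, -1)}`
    (∀ n : ℕ, ∃ ρ : compactSp n × unitQuaternion →*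
          (LinearSpaceOver ℍ[ℝ] n ≃ₗᵢ[ℝ] LinearSpaceOver ℍ[ℝ] n),
      (∀ (B : compactSp n) (q : unitQuaternion) (v : LinearSpaceOver ℍ[ℝ] n),
        ρ (B, q) v = rightMul (WithLp.toLp 2 (B.1 *ᵥ WithLp.ofLp v)) (q.1)⁻¹) ∧
      ρ.range = twistedIso ℍ[ℝ] n ∧
      (0 < n → ∀ (B : compactSp n) (q : unitQuaternion),
        (B, q) ∈ ρ.ker ↔ (B.1 = 1 ∧ q.1 = 1) ∨ (B.1 = -1 ∧ q.1 = -1))) ∧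
    -- `G_𝕆(1) = Spin(7)`, acting on `𝕆 = ℝ⁸` by the spin representation, i.e. by the restriction
    -- to `Spin(7)` of a representation of the even Clifford algebra of `ℝ⁷`
    (∃ (Ψ : CliffordAlgebra.even euclideanForm7 →ₐ[ℝ] Module.End ℝ (LinearSpaceOver Octonion 1))
        (e : Spin7 ≃* twistedIso Octonion 1),
      ∀ (s : Spin7) (v : LinearSpaceOver Octonion 1),
        (e s).1 v = Ψ (Spin7.toEven s) v) := by
  refine ⟨exists_twistedIso_equiv_unitary fun θ _ => real_isometry_eq_one θ,
    exists_twistedIso_equiv_unitary complex_rotation_eq_one,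
    fun n => ⟨spAction n, spAction_apply, range_spAction n, mem_ker_spAction⟩,
    ((Spin7.lineEquiv.symm.toLinearEquiv.conjAlgEquiv ℝ :
        Module.End ℝ Octonion →ₐ[ℝ] Module.End ℝ (LinearSpaceOver Octonion 1)).comp Spin7.spinRep),
    (MonoidHom.ofInjective Spin7.lineAction_injective).trans
      (MulEquiv.subgroupCongr Spin7.range_lineAction), fun s v => rfl⟩
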